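/- Let $G=(V,E)$ be a finite simple graph and $e=\{u,v\}\in E$. For $x\in\{u,v\}$ let $\mathbb{P}_x$ be the uniform distribution on the closed neighbourhood $\{x\}\cup\mathrm{Nbr}_G(x)$, let $\mathrm{EMD}(\mathbb{P}_u,\mathbb{P}_v)$ be the earth mover's distance (optimal value of the transportation linear program) with respect to the shortest-path metric $\mathrm{dist}_G$, and let $\mathfrak{C}_G(e)=1-\mathrm{EMD}(\mathbb{P}_u,\mathbb{P}_v)$ be the Ollivier–Ricci curvature of $e$. Let $H=(L,R,w)$ be the complete edge-weighted bipartite graph with sides $L=\mathrm{Nbr}_G(u)\setminus(\mathrm{Nbr}_G(v)\cup\{v\})$ and $R=\mathrm{Nbr}_G(v)\setminus(\mathrm{Nbr}_G(u)\cup\{u\})$ and weights $w(x,y)=\mathrm{dist}_G(x,y)\in\{1,2,3\}$. For $j\in\{1,2\}$ let $\deg_{H,j}(x)$ be the number of edges of weight $j$ of $H$ at the node $x\in L\cup R$. A local algorithm knows $\deg_G(u)$, $\deg_G(v)$ and the lists of the nodes of $L$ and $R$, but not the weights $w$. It may draw random elements (in particular, sample nodes) and make weighted neighbour queries $(x,s)$,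 where $x\in L\cup R$ and $s$ is a number; the answer is a uniformly random node $z$ such that $\{x,z\}$ is an edge of $H$ of weight $s$ that no earlier answer has revealed, or a special symbol if there is no such node. Its cost is the number of queries. A number $\kappa$ is an additive $a$-approximation of $\mathfrak{C}_G(e)$ if $\mathrm{EMD}(\mathbb{P}_u,\mathbb{P}_v)\le 1-\kappa\le \mathrm{EMD}(\mathbb{P}_u,\mathbb{P}_v)+a$, that is, $\mathfrak{C}_G(e)-a\le\kappa\le\mathfrak{C}_G(e)$. Theorem. Let $d,\varepsilon>0$ be constants and let $\eta>0$ be any constant failure probability. There is a constant $C$ that depends only on $d,\varepsilon,\eta$ such that the following holds for all $G$ and $e=\{u,v\}\in E$ with $\deg_G(u)=\deg_G(v)$. (a) There is a randomized local algorithm that, whenever $\deg_{H,1}(x)\le d$ for every node $x$ of $H$, makes at most $C$ weighted neighbour queries in expectation and, with probability at least $1-\eta$, outputs an additive $(1+\varepsilon)$-approximation of $\mathfrak{C}_G(e)$. (b) There is a randomized local algorithm that, whenever $\deg_{H,1}(x)\le d$ and $\deg_{H,2}(x)\le d$ for every node $x$ of $H$, makes at most $C$ weighted neighbour queries in expectation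 and, with probability at least $1-\eta$, outputs an additive $(\tfrac12+\varepsilon)$-approximation of $\mathfrak{C}_G(e)$. The algorithms depend on $d,\varepsilon,\eta$ and, apart from the names of the nodes, only on $\deg_G(v)$ and $|L|=|R|$. -/

import Mathlib

open scoped ENNReal NNReal

noncomputable section

namespace OllivierRicci

section Curvature

variable {V : Type*} [Fintype V] [DecidableEq V]

/-- Feasibility for the transportation linear program between the distributions `μ` on `A` and `ν`
on `B`: row sums are `μ`, column sums are `ν`, all entries are nonnegative. -/
def IsTransportPlan (A B : Finset V) (μ ν : V → ℝ) (z : V → V → ℝ) : Prop :=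
  (∀ x ∈ A, ∑ y ∈ B, z x y = μ x) ∧
  (∀ y ∈ B, ∑ x ∈ A, z x y = ν y) ∧
  (∀ x ∈ A, ∀ y ∈ B, 0 ≤ z x y)

/-- Earth mover's distance over the complete bipartite graph with sides `A`, `B` and edge weights
`w`: the optimal value of the transportation linear program. -/
def emd (A B : Finset V) (w : V → V → ℝ) (μ ν : V → ℝ) : ℝ :=
  sInf {c : ℝ | ∃ z : V → V → ℝ, IsTransportPlan A B μ ν z ∧
    c = ∑ x ∈ A, ∑ y ∈ B, w x y * z x y}

variable (G : SimpleGraph V) [DecidableRel G.Adj]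

/-- The closed neighbourhood `{x} ∪ Nbr(x)`. -/
def closedNbr (x : V) : Finset V := insert x (G.neighborFinset x)

/-- The earth mover's distance, for the shortest-path metric of `G`, between the uniform
distributions on the closed neighbourhoods of `u` and of `v`. -/
def edgeEmd (u v : V) : ℝ :=
  emd (closedNbr G u) (closedNbr G v) (fun x y => (G.dist x y : ℝ))
    (fun _ => 1 / (1 + (G.degree u : ℝ))) (fun _ => 1 / (1 + (G.degree v : ℝ)))

/-- Ollivier-Ricci curvature of the edge `{u, v}`. -/
def curvature (u v : V) : ℝ := 1 - edgeEmd G u v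

/-- `Nbr(u) \ (Nbr(v) ∪ {v})`. The two sides of the bipartite graph `H` attached to the edge
`{u, v}` are `L = privateNbr G u v` and `R = privateNbr G v u`. -/
def privateNbr (u v : V) : Finset V := G.neighborFinset u \ (G.neighborFinset v ∪ {v})

/-- The weights of `H`, for given enumerations `L = {u₁, …, uₙ}` and `R = {v₁, …, vₙ}`:
the weight of the edge `(i, j)` is the distance in `G` of `uᵢ` and `vⱼ`. -/
def hWeight {u v : V} {n : ℕ} (eL : Fin n ≃ privateNbr G u v) (eR : Fin n ≃ privateNbr G v u) :
    Fin n × Fin n → ℕ :=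
  fun e => G.dist (eL e.1 : V) (eR e.2 : V)

/-- `β` is a value that an additive `a`-approximation of a minimization problem with optimal value
`opt` may produce. -/
def IsAdditiveEstimate (a opt β : ℝ) : Prop := opt ≤ β ∧ β ≤ opt + a

/-- `κ` is an additive `a`-approximation of the curvature of `{u, v}`: the number `1 - κ` is an
additive `a`-approximation of the optimal value of the linear program that defines the
curvature. -/
def IsAdditiveCurvatureApprox (u v : V) (a κ : ℝ) : Prop :=
  IsAdditiveEstimate a (edgeEmd G u v) (1 - κ)

end Curvature

section LocalAlgorithms

/-- The nodes of a bipartite graph with sides `{u₁, …, uₙ}` and `{v₁, …, vₙ}`: `Sum.inl i` is `uᵢ`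
and `Sum.inr j` is `vⱼ`. -/
abbrev Node (n : ℕ) : Type := Fin n ⊕ Fin n

/-- The edge that joins the node `x` to the `z`-th node of the opposite side. -/
def edgeAt {n : ℕ} (x : Node n) (z : Fin n) : Fin n × Fin n :=
  match x with
  | Sum.inl i => (i, z)
  | Sum.inr j => (z, j)

/-- The number of edges of weight `s` at the node `x`. -/
def weightDegree {n : ℕ} (w : Fin n × Fin n → ℕ) (s : ℕ) (x : Node n) : ℕ :=
  (Finset.univ.filter fun z : Fin n => w (edgeAt x z) = s).card

/-- Randomized local algorithms on a complete bipartite graph with `n` labelled nodes on each side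
and unknown edge weights. Such an algorithm stops with an output, or draws a uniformly random
element of `Fin (k + 1)`, or makes a weighted neighbour query `(x, s)`; the answer to the query is
`none`, or the index of a node of the side opposite to `x`. -/
inductive QueryAlg (n : ℕ) : Type
  | output (κ : ℚ) : QueryAlg n
  | sample (k : ℕ) (next : Fin (k + 1) → QueryAlg n) : QueryAlg n
  | query (x : Node n) (s : ℕ) (next : Option (Fin n) → QueryAlg n) : QueryAlg n

/-- The nodes (on the side opposite to `x`) joined to `x` by an edge of weight `s` that is not in
the set `S` of edges explored so far. -/
def unexplored {n : ℕ} (w : Fin n × Fin n → ℕ) (S : Finset (Fin n × Fin n)) (x : Node n) (s : ℕ) :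
    Finset (Fin n) :=
  Finset.univ.filter fun z => w (edgeAt x z) = s ∧ edgeAt x z ∉ S

open Classical in
/-- The random answer to the weighted neighbour query `(x, s)`: a uniformly random not yet explored
node `z` with weight `s` from `x`, or `none` if there is no such node. -/
def answer {n : ℕ} (w : Fin n × Fin n → ℕ) (S : Finset (Fin n × Fin n)) (x : Node n) (s : ℕ) :
    PMF (Option (Fin n)) :=
  if h : (unexplored w S x s).Nonempty then
    (PMF.uniformOfFinset (unexplored w S x s) h).map some
  else PMF.pure none

/-- The set of explored edges after the answer to a query at `x`. -/
def explore {n : ℕ} (S : Finset (Fin n × Fin n)) (x : Node n) :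
    Option (Fin n) → Finset (Fin n × Fin n)
  | none => S
  | some z => insert (edgeAt x z) S

/-- The joint distribution of the output and of the number of queries, when the algorithm runs on
the weights `w` and the edges in `S` are already explored. -/
def QueryAlg.runFrom {n : ℕ} (w : Fin n × Fin n → ℕ) :
    QueryAlg n → Finset (Fin n × Fin n) → PMF (ℚ × ℕ)
  | .output κ, _ => PMF.pure (κ, 0)
  | .sample k next, S =>
      (PMF.uniformOfFintype (Fin (k + 1))).bind fun i => (next i).runFrom w S
  | .query x s next, S =>
      (answer w S x s).bind fun a =>
        ((next a).runFrom w (explore S x a)).map fun o => (o.1, o.2 + 1)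

/-- The joint distribution of the output and of the number of queries on the weights `w`. -/
def QueryAlg.run {n : ℕ} (A : QueryAlg n) (w : Fin n × Fin n → ℕ) : PMF (ℚ × ℕ) :=
  A.runFrom w ∅

/-- The expected number of weighted neighbour queries. -/
def QueryAlg.expectedQueries {n : ℕ} (A : QueryAlg n) (w : Fin n × Fin n → ℕ) : ℝ≥0∞ :=
  ∑' o : ℚ × ℕ, A.run w o * (o.2 : ℝ≥0∞)

/-- The probability that the output has the property `P`. -/
def QueryAlg.probOutput {n : ℕ} (A : QueryAlg n) (w : Fin n × Fin n → ℕ) (P : ℚ → Prop) : ℝ≥0∞ :=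
  (A.run w).toOuterMeasure {o | P o.1}

end LocalAlgorithms

end OllivierRicci

end

open scoped ENNReal NNReal

noncomputable section

namespace OllivierRicci

/-! ### The auction: invariants and progress. -/

section Auction

/-! Put `E = edgeEmd G u v * (1 + G.degree u)`. Mass on common neighbours can stay in place, so `E`
lies between the value of any feasible dual potentials on `H` and the weight of any perfect matching
of `H` (`le_edgeEmd`, `edgeEmd_le`). Weights are at most 3, so a cheap matching is one with a large
total saving `3 - w`. If only savings on weights in `T` count, the edges of nonzero saving form a
graph of bounded degree `Δ`.

An auction with integer prices and values scaled by `M` yields in every round a matching together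
with almost optimal dual potentials: the gap is at most `n / M` plus 3 per active bidder, plus `3 -
c` per node for the ignored weights (`edgeEmd_mul_le`, `le_edgeEmd_mul`). Prices are bounded, and
their sum grows in each round by at least the number of active bidders over `Δ`. Hence the number of
active bidders is small on average over a constant number `N` of rounds
(`sum_card_activeBidders_le`), and the profit averaged over these rounds is nearly optimal
(`edgeEmd_bounds`).

The auction is local (`auction_congr`): the mean profit from an object depends on the ball of radius
`2 * N` around it, which constantly many queries reveal (`realizes_exploreBall`). Chebyshev's
inequality then permits averaging over a constant number of sampled objects.

With `T = [1]` one has `c = 2` and error `1 + ε`. With `T = [1, 2]` one has `c = 3` and error `ε`,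
which is more than part (b) needs. -/

/-- The state of an auction of `n` objects to `n` bidders: the current price of every object, and
its current owner, if any. -/
structure AuctionState (n : ℕ) where
  price : Fin n → ℕ
  owner : Fin n → Option (Fin n)

variable {n : ℕ}

/-- The net value of the object `j` for the bidder `i` when the values are `M * φ (i, j)`. -/
def netValue (M : ℕ) (φ : Fin n × Fin n → ℕ) (st : AuctionState n) (i j : Fin n) : ℕ :=
  M * φ (i, j) - st.price j

/-- The largest net value of an object for the bidder `i`. -/
def utility (M : ℕ) (φ : Fin n × Fin n → ℕ) (st : AuctionState n) (i : Fin n) : ℕ :=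
  Finset.univ.sup (netValue M φ st i)

/-- The object for which the bidder `i` bids: a bidder without an object bids for an object of
largest net value, provided that this net value is positive. -/
def bid (M : ℕ) (φ : Fin n × Fin n → ℕ) (st : AuctionState n) (i : Fin n) : Option (Fin n) :=
  -- By `profit_ne_zero`, the condition `φ (i, j) ≠ 0` excludes no object owned in the course of the
  -- auction; it makes the bid depend only on neighbours of `i`.
  if ∃ j, φ (i, j) ≠ 0 ∧ st.owner j = some i then none
  else (List.finRange n).find? fun j =>
    decide (0 < netValue M φ st i j ∧ netValue M φ st i j = utility M φ st i)

/-- The winner of the object `j`: one of those who bid for it. -/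
def winner (M : ℕ) (φ : Fin n × Fin n → ℕ) (st : AuctionState n) (j : Fin n) : Option (Fin n) :=
  (List.finRange n).find? fun i => decide (bid M φ st i = some j)

/-- One round of the auction: every object with a bid passes to its winner, at a price increased
by one. -/
def auctionStep (M : ℕ) (φ : Fin n × Fin n → ℕ) (st : AuctionState n) : AuctionState n where
  price j := if (winner M φ st j).isSome then st.price j + 1 else st.price j
  owner j := (winner M φ st j).or (st.owner j)

/-- The state after `t` rounds. -/
def auction (M : ℕ) (φ : Fin n × Fin n → ℕ) : ℕ → AuctionState n
  | 0 => ⟨fun _ => 0, fun _ => none⟩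
  | t + 1 => auctionStep M φ (auction M φ t)

/-- The value of the object `j` for its owner. -/
def ownerProfit (φ : Fin n × Fin n → ℕ) (st : AuctionState n) (j : Fin n) : ℕ :=
  (st.owner j).elim 0 fun i => φ (i, j)

/-- The bidders without an object for whom some object has positive net value. -/
def activeBidders (M : ℕ) (φ : Fin n × Fin n → ℕ) (st : AuctionState n) : Finset (Fin n) :=
  Finset.univ.filter fun i => (∀ j, st.owner j ≠ some i) ∧ 0 < utility M φ st i

/-- This is dual feasibility: as subtraction truncates, it says `M * φ (i, j) ≤ utility + price`. -/
theorem netValue_le_utility (M : ℕ) (φ : Fin n × Fin n → ℕ) (st : AuctionState n) (i j : Fin n) :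
    netValue M φ st i j ≤ utility M φ st i :=
  Finset.le_sup (f := netValue M φ st i) (Finset.mem_univ j)

theorem bid_eq_some {M : ℕ} {φ : Fin n × Fin n → ℕ} {st : AuctionState n} {i j : Fin n}
    (h : bid M φ st i = some j) :
    (∀ k, φ (i, k) ≠ 0 → st.owner k ≠ some i) ∧ 0 < netValue M φ st i j ∧
      netValue M φ st i j = utility M φ st i := by
  unfold bid at h
  split_ifs at h with h1
  push Not at h1
  exact ⟨h1, by simpa using List.find?_some h⟩

theorem winner_eq_some {M : ℕ} {φ : Fin n × Fin n → ℕ} {st : AuctionState n} {i j : Fin n}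
    (h : winner M φ st j = some i) : bid M φ st i = some j := by
  simpa using List.find?_some h

theorem winner_isSome_of_bid {M : ℕ} {φ : Fin n × Fin n → ℕ} {st : AuctionState n} {i j : Fin n}
    (h : bid M φ st i = some j) : (winner M φ st j).isSome := by
  unfold winner
  rw [List.find?_isSome]
  exact ⟨i, List.mem_finRange i, by simpa using h⟩

theorem netValue_pos {M : ℕ} {φ : Fin n × Fin n → ℕ} {st : AuctionState n} {i j : Fin n}
    (h : 0 < netValue M φ st i j) : φ (i, j) ≠ 0 ∧ st.price j < M * φ (i, j) := by
  unfold netValue at h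
  refine ⟨fun h0 => by simp [h0] at h, by omega⟩

/-- The invariants of the auction. -/
structure AuctionInvariant (M B : ℕ) (φ : Fin n × Fin n → ℕ) (st : AuctionState n) : Prop where
  profit_ne_zero : ∀ i j, st.owner j = some i → φ (i, j) ≠ 0
  injective : ∀ i j k, st.owner j = some i → st.owner k = some i → j = k
  price_eq_zero : ∀ j, st.owner j = none → st.price j = 0
  -- Approximate complementary slackness: an owner is within one price increment of his best option.
  slack : ∀ i j, st.owner j = some i → utility M φ st i + st.price j ≤ M * φ (i, j) + 1
  price_le : ∀ j, st.price j ≤ M * B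

/-- Prices never fall, so slackness persists while an object keeps its owner. -/
theorem utility_auctionStep_le (M : ℕ) (φ : Fin n × Fin n → ℕ) (st : AuctionState n) (i : Fin n) :
    utility M φ (auctionStep M φ st) i ≤ utility M φ st i := by
  refine Finset.sup_mono_fun fun j _ => ?_
  unfold netValue auctionStep
  dsimp only
  split_ifs <;> omega

/-- Owners of an object of nonzero value do not bid, which keeps ownership injective. A winner has
bid for a best object, so the increment costs him a slack of one. A bid needs positive net value,
which bounds the price. -/
theorem AuctionInvariant.step {M B : ℕ} {φ : Fin n × Fin n → ℕ} {st : AuctionState n}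
    (hφ : ∀ e, φ e ≤ B) (h : AuctionInvariant M B φ st) :
    AuctionInvariant M B φ (auctionStep M φ st) := by
  have key : ∀ i j, (auctionStep M φ st).owner j = some i →
      winner M φ st j = some i ∨ (winner M φ st j = none ∧ st.owner j = some i) := by
    intro i j hij
    simp only [auctionStep] at hij
    cases hw : winner M φ st j with
    | none => right; simpa [hw] using hij
    | some k => left; simpa [hw] using hij
  refine ⟨?_, ?_, ?_, ?_, ?_⟩
  · intro i j hij
    rcases key i j hij with hw | ⟨-, ho⟩
    · exact (netValue_pos (bid_eq_some (winner_eq_some hw)).2.1).1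
    · exact h.profit_ne_zero i j ho
  · intro i j k hj hk
    rcases key i j hj with hw | ⟨-, ho⟩ <;> rcases key i k hk with hw' | ⟨-, ho'⟩
    · have := (winner_eq_some hw).symm.trans (winner_eq_some hw')
      simpa using this
    · exact absurd ho' ((bid_eq_some (winner_eq_some hw)).1 k (h.profit_ne_zero i k ho'))
    · exact absurd ho ((bid_eq_some (winner_eq_some hw')).1 j (h.profit_ne_zero i j ho))
    · exact h.injective i j k ho ho'
  · intro j hj
    simp only [auctionStep, Option.or_eq_none_iff] at hj ⊢
    simp [hj.1, h.price_eq_zero j hj.2]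
  · intro i j hij
    have hu := utility_auctionStep_le M φ st i
    rcases key i j hij with hw | ⟨hw, ho⟩
    · obtain ⟨-, hpos, heq⟩ := bid_eq_some (winner_eq_some hw)
      have hp : (auctionStep M φ st).price j = st.price j + 1 := by simp [auctionStep, hw]
      rw [hp]
      unfold netValue at hpos heq
      omega
    · have hp : (auctionStep M φ st).price j = st.price j := by simp [auctionStep, hw]
      rw [hp]
      have := h.slack i j ho
      omega
  · intro j
    cases hw : winner M φ st j with
    | none =>
      have hp : (auctionStep M φ st).price j = st.price j := by simp [auctionStep, hw]
      rw [hp]; exact h.price_le j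
    | some i =>
      have hp : (auctionStep M φ st).price j = st.price j + 1 := by simp [auctionStep, hw]
      rw [hp]
      have := (netValue_pos (bid_eq_some (winner_eq_some hw)).2.1).2
      have := Nat.mul_le_mul_left M (hφ (i, j))
      omega

theorem auctionInvariant_auction (M : ℕ) {B : ℕ} {φ : Fin n × Fin n → ℕ} (hφ : ∀ e, φ e ≤ B)
    (t : ℕ) : AuctionInvariant M B φ (auction M φ t) := by
  induction t with
  | zero => constructor <;> simp [auction]
  | succ t ih => exact ih.step hφ

theorem exists_bid_of_mem_activeBidders {M : ℕ} {φ : Fin n × Fin n → ℕ} {st : AuctionState n}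
    {i : Fin n} (hi : i ∈ activeBidders M φ st) : ∃ j, bid M φ st i = some j := by
  simp only [activeBidders, Finset.mem_filter, Finset.mem_univ, true_and] at hi
  obtain ⟨ho, hu⟩ := hi
  obtain ⟨j, -, hj⟩ := Finset.exists_mem_eq_sup Finset.univ ⟨i, Finset.mem_univ i⟩
    (netValue M φ st i)
  have hneg : ¬ ∃ j, φ (i, j) ≠ 0 ∧ st.owner j = some i := fun ⟨j, _, h⟩ => ho j h
  rw [← Option.isSome_iff_exists, bid, if_neg hneg, List.find?_isSome]
  refine ⟨j, List.mem_finRange j, ?_⟩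
  have : utility M φ st i = netValue M φ st i j := hj
  simp only [decide_eq_true_eq]
  omega

/-- In every round the sum of the prices grows by at least the number of active bidders over the
maximum degree. -/
theorem card_activeBidders_le {M Δ : ℕ} {φ : Fin n × Fin n → ℕ} (st : AuctionState n)
    (hΔ : ∀ j, (Finset.univ.filter fun i => φ (i, j) ≠ 0).card ≤ Δ) :
    (activeBidders M φ st).card + Δ * ∑ j, st.price j ≤
      Δ * ∑ j, (auctionStep M φ st).price j := by
  set W := Finset.univ.filter fun j => (winner M φ st j).isSome with hW
  have hsum : ∑ j, (auctionStep M φ st).price j = ∑ j, st.price j + W.card := by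
    rw [hW, Finset.card_filter, ← Finset.sum_add_distrib]
    refine Finset.sum_congr rfl fun j _ => ?_
    simp only [auctionStep]
    split_ifs <;> simp
  -- Each active bidder bids for exactly one object, and an object receives bids only from its at
  -- most `Δ` neighbours.
  have hcard : (activeBidders M φ st).card ≤ Δ * W.card := by
    rcases (activeBidders M φ st).eq_empty_or_nonempty with h0 | ⟨i₀, _⟩
    · simp [h0]
    let f : Fin n → Fin n := fun i => (bid M φ st i).getD i₀
    have hf : ∀ i ∈ activeBidders M φ st, bid M φ st i = some (f i) := by
      intro i hi
      obtain ⟨j, hj⟩ := exists_bid_of_mem_activeBidders hi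
      simp [f, hj]
    refine Finset.card_le_mul_card_image_of_maps_to (f := f) ?_ Δ ?_
    · intro i hi
      rw [hW, Finset.mem_filter]
      exact ⟨Finset.mem_univ _, winner_isSome_of_bid (hf i hi)⟩
    · intro j _
      refine le_trans (Finset.card_le_card fun i hi => ?_) (hΔ j)
      rw [Finset.mem_filter] at hi ⊢
      obtain ⟨hi, rfl⟩ := hi
      exact ⟨Finset.mem_univ _, (netValue_pos (bid_eq_some (hf i hi)).2.1).1⟩
  rw [hsum, Nat.mul_add]
  omega

/-- The growth of the prices telescopes and their sum is at most `n * (M * B)`, so the bound does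
not depend on `T`. -/
theorem sum_card_activeBidders_le (M : ℕ) {B Δ : ℕ} {φ : Fin n × Fin n → ℕ}
    (hφ : ∀ e, φ e ≤ B) (hΔ : ∀ j, (Finset.univ.filter fun i => φ (i, j) ≠ 0).card ≤ Δ) (T : ℕ) :
    ∑ t ∈ Finset.range T, (activeBidders M φ (auction M φ t)).card ≤ Δ * (n * (M * B)) := by
  have h : ∑ t ∈ Finset.range T, (activeBidders M φ (auction M φ t)).card ≤
      Δ * ∑ j, (auction M φ T).price j := by
    induction T with
    | zero => simp
    | succ T ih =>
      rw [Finset.sum_range_succ]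
      have := card_activeBidders_le (M := M) (auction M φ T) hΔ
      simp only [auction]
      omega
  refine h.trans (Nat.mul_le_mul_left _ ?_)
  refine (Finset.sum_le_card_nsmul _ _ (M * B) fun j _ =>
    (auctionInvariant_auction M hφ T).price_le j).trans ?_
  simp

/-- The utilities and the prices are an almost optimal solution of the dual linear program, up to
the active bidders. -/
theorem AuctionInvariant.sum_le {M B : ℕ} {φ : Fin n × Fin n → ℕ} {st : AuctionState n}
    (hφ : ∀ e, φ e ≤ B) (h : AuctionInvariant M B φ st) :
    ∑ i, utility M φ st i + ∑ j, st.price j ≤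
      M * ∑ j, ownerProfit φ st j + n + M * B * (activeBidders M φ st).card := by
  -- The utility of a bidder is charged to the object he owns. Without an object, he has utility
  -- zero or is active.
  have h1 : ∀ i, utility M φ st i ≤ (∑ j, if st.owner j = some i then utility M φ st i else 0) +
      if i ∈ activeBidders M φ st then M * B else 0 := by
    intro i
    by_cases ho : ∃ j, st.owner j = some i
    · obtain ⟨j, hj⟩ := ho
      have := Finset.single_le_sum
        (f := fun j => if st.owner j = some i then utility M φ st i else 0)
        (fun _ _ => Nat.zero_le _) (Finset.mem_univ j)
      simp only [hj, if_true] at this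
      omega
    · push Not at ho
      rcases Nat.eq_zero_or_pos (utility M φ st i) with h0 | hpos
      · omega
      · have : i ∈ activeBidders M φ st := by simp [activeBidders, ho, hpos]
        rw [if_pos this]
        refine le_trans (Finset.sup_le fun j _ => ?_) (Nat.le_add_left _ _)
        exact (Nat.sub_le _ _).trans (Nat.mul_le_mul_left _ (hφ _))
  have h2 : ∀ j, (∑ i, if st.owner j = some i then utility M φ st i else 0) + st.price j ≤
      M * ownerProfit φ st j + 1 := by
    intro j
    cases ho : st.owner j with
    | none => simp [h.price_eq_zero j ho]
    | some k =>
      have := h.slack k j ho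
      simpa [ownerProfit, ho] using this
  have h3 := Finset.sum_le_sum fun i (_ : i ∈ Finset.univ) => h1 i
  have h4 := Finset.sum_le_sum fun j (_ : j ∈ Finset.univ) => h2 j
  rw [Finset.sum_add_distrib, Finset.sum_comm] at h3
  rw [Finset.sum_add_distrib, Finset.sum_add_distrib, ← Finset.mul_sum] at h4
  have h5 : (∑ i, if i ∈ activeBidders M φ st then M * B else 0) =
      M * B * (activeBidders M φ st).card := by
    rw [← Finset.sum_filter, Finset.filter_mem_eq_inter, Finset.univ_inter, Finset.sum_const,
      smul_eq_mul, mul_comm]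
  simp only [Finset.sum_const, Finset.card_univ, Fintype.card_fin, smul_eq_mul, mul_one] at h4
  omega

/-! ### Locality of the auction. -/

/-- The end other than `x` of the edge from `x` to the `z`-th node of the opposite side. -/
def farEnd (x : Node n) (z : Fin n) : Node n :=
  match x with
  | Sum.inl _ => Sum.inr z
  | Sum.inr _ => Sum.inl z

/-- The values `φ` and `φ'` agree on all edges at the nodes at distance less than `r` of `x`, for
the distance in the graph of the edges of nonzero value. -/
def AgreeWithin (φ φ' : Fin n × Fin n → ℕ) : ℕ → Node n → Prop
  | 0, _ => True
  | r + 1, x => (∀ z, φ (edgeAt x z) = φ' (edgeAt x z)) ∧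
      ∀ z, φ (edgeAt x z) ≠ 0 → AgreeWithin φ φ' r (farEnd x z)

theorem AgreeWithin.of_succ {φ φ' : Fin n × Fin n → ℕ} {r : ℕ} :
    ∀ {x : Node n}, AgreeWithin φ φ' (r + 1) x → AgreeWithin φ φ' r x := by
  induction r with
  | zero => intro x _; trivial
  | succ r ih => exact fun h => ⟨h.1, fun z hz => ih (h.2 z hz)⟩

theorem AgreeWithin.mono {φ φ' : Fin n × Fin n → ℕ} {r s : ℕ} {x : Node n} (hrs : r ≤ s)
    (h : AgreeWithin φ φ' s x) : AgreeWithin φ φ' r x := by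
  induction hrs with
  | refl => exact h
  | step _ ih => exact ih h.of_succ

/-- An object of value zero has net value zero at any price, so its state cannot influence the bid.
-/
theorem bid_congr {M : ℕ} {φ φ' : Fin n × Fin n → ℕ} {st st' : AuctionState n} {i : Fin n}
    (hφ : ∀ j, φ (i, j) = φ' (i, j))
    (hst : ∀ j, φ (i, j) ≠ 0 → st.price j = st'.price j ∧ st.owner j = st'.owner j) :
    bid M φ st i = bid M φ' st' i := by
  have hn : netValue M φ st i = netValue M φ' st' i := by
    funext j
    unfold netValue
    rw [← hφ j]
    by_cases h0 : φ (i, j) = 0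
    · simp [h0]
    · rw [(hst j h0).1]
  have ho : (∃ j, φ (i, j) ≠ 0 ∧ st.owner j = some i) ↔
      ∃ j, φ' (i, j) ≠ 0 ∧ st'.owner j = some i := by
    refine exists_congr fun j => ?_
    rw [← hφ j]
    exact and_congr_right fun h0 => by rw [(hst j h0).2]
  unfold bid utility
  simp only [ho, hn]

/-- The auction is local: the price and the owner of `j` after `t` rounds depend only on the
edges at the nodes near `j`. -/
theorem auction_congr {M : ℕ} {φ φ' : Fin n × Fin n → ℕ} {t : ℕ} :
    ∀ {j : Fin n}, AgreeWithin φ φ' (2 * t) (Sum.inr j) →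
      (auction M φ t).price j = (auction M φ' t).price j ∧
        (auction M φ t).owner j = (auction M φ' t).owner j := by
  induction t with
  | zero => intro j _; simp [auction]
  | succ t ih =>
    intro j h
    obtain ⟨hp, ho⟩ := ih (h.mono (by omega))
    have hw : winner M φ (auction M φ t) j = winner M φ' (auction M φ' t) j := by
      unfold winner
      congr 1
      funext i
      by_cases h0 : φ (i, j) = 0
      · have h0' : φ' (i, j) = 0 := (h.1 i).symm.trans h0
        have e1 : bid M φ (auction M φ t) i ≠ some j := fun hb =>
          (netValue_pos (bid_eq_some hb).2.1).1 h0
        have e2 : bid M φ' (auction M φ' t) i ≠ some j := fun hb =>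
          (netValue_pos (bid_eq_some hb).2.1).1 h0'
        simp [e1, e2]
      -- A round costs two steps of radius: the winner of `j` depends on the bids of its neighbours
      -- `i`, and these on the state of the neighbours `k` of `i`.
      · obtain ⟨h1, h2⟩ := h.2 i h0
        rw [bid_congr h1 fun k hk => ih (h2 k hk)]
    simp only [auction, auctionStep, hw, hp, ho, and_self]

/-- The extra step of radius makes the edges at `j` agree even for `t = 0`. As only rounds `t < T`
enter `meanProfit`, radius `2 * T` still suffices there. -/
theorem ownerProfit_auction_congr {M : ℕ} {φ φ' : Fin n × Fin n → ℕ} {t : ℕ} {j : Fin n}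
    (h : AgreeWithin φ φ' (2 * t + 1) (Sum.inr j)) :
    ownerProfit φ (auction M φ t) j = ownerProfit φ' (auction M φ' t) j := by
  unfold ownerProfit
  rw [(auction_congr h.of_succ).2]
  congr 1
  funext i
  exact h.1 i

/-- The profit from the object `j`, on average over the first `T` rounds. -/
def meanProfit (M : ℕ) (φ : Fin n × Fin n → ℕ) (T : ℕ) (j : Fin n) : ℚ :=
  (∑ t ∈ Finset.range T, (ownerProfit φ (auction M φ t) j : ℚ)) / T

theorem meanProfit_congr {M : ℕ} {φ φ' : Fin n × Fin n → ℕ} {T : ℕ} {j : Fin n}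
    (h : AgreeWithin φ φ' (2 * T) (Sum.inr j)) : meanProfit M φ T j = meanProfit M φ' T j := by
  unfold meanProfit
  congr 1
  refine Finset.sum_congr rfl fun t ht => ?_
  rw [Finset.mem_range] at ht
  rw [ownerProfit_auction_congr (h.mono (by omega))]

theorem ownerProfit_le {B : ℕ} {φ : Fin n × Fin n → ℕ} (hφ : ∀ e, φ e ≤ B) (st : AuctionState n)
    (j : Fin n) : ownerProfit φ st j ≤ B := by
  unfold ownerProfit
  cases st.owner j with
  | none => simp
  | some i => exact hφ _

theorem meanProfit_nonneg (M : ℕ) (φ : Fin n × Fin n → ℕ) (T : ℕ) (j : Fin n) :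
    0 ≤ meanProfit M φ T j := by
  unfold meanProfit
  positivity

theorem meanProfit_le {M B : ℕ} {φ : Fin n × Fin n → ℕ} (hφ : ∀ e, φ e ≤ B) (T : ℕ)
    (j : Fin n) : meanProfit M φ T j ≤ B := by
  unfold meanProfit
  refine div_le_of_le_mul₀ (by positivity) (by positivity) ?_
  refine (Finset.sum_le_card_nsmul _ _ (B : ℚ) fun t _ => ?_).trans (by simp [mul_comm])
  exact_mod_cast ownerProfit_le hφ _ j

end Auction

/-! ### Output distribution and query count. -/

section Semantics

variable {n : ℕ} {w : Fin n × Fin n → ℕ}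

/-- On the weights `w`, with the edges in `S` already explored, the output of `A` has the
distribution `p`, and `A` never makes more than `c` queries. -/
def Realizes (w : Fin n × Fin n → ℕ) (S : Finset (Fin n × Fin n)) (A : QueryAlg n) (p : PMF ℚ)
    (c : ℕ) : Prop :=
  (A.runFrom w S).map Prod.fst = p ∧ ∀ o ∈ (A.runFrom w S).support, o.2 ≤ c

theorem Realizes.mono {S : Finset (Fin n × Fin n)} {A : QueryAlg n} {p : PMF ℚ} {c c' : ℕ}
    (h : Realizes w S A p c) (hc : c ≤ c') : Realizes w S A p c' :=
  ⟨h.1, fun o ho => (h.2 o ho).trans hc⟩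

theorem realizes_output (w : Fin n × Fin n → ℕ) (S : Finset (Fin n × Fin n)) (κ : ℚ) :
    Realizes w S (.output κ) (PMF.pure κ) 0 := by
  refine ⟨by simp [QueryAlg.runFrom, PMF.pure_map], fun o ho => ?_⟩
  simp only [QueryAlg.runFrom, PMF.support_pure, Set.mem_singleton_iff] at ho
  simp [ho]

theorem realizes_sample {S : Finset (Fin n × Fin n)} {k : ℕ} {next : Fin (k + 1) → QueryAlg n}
    {p : Fin (k + 1) → PMF ℚ} {c : ℕ} (h : ∀ i, Realizes w S (next i) (p i) c) :
    Realizes w S (.sample k next) ((PMF.uniformOfFintype (Fin (k + 1))).bind p) c := by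
  refine ⟨?_, fun o ho => ?_⟩
  · simp only [QueryAlg.runFrom, PMF.map_bind]
    congr 1
    funext i
    exact (h i).1
  · simp only [QueryAlg.runFrom, PMF.mem_support_bind_iff] at ho
    obtain ⟨i, -, hi⟩ := ho
    exact (h i).2 o hi

theorem PMF.bind_eq_of_forall_support {α β : Type*} {p : PMF α} {f : α → PMF β} {q : PMF β}
    (h : ∀ a ∈ p.support, f a = q) : p.bind f = q := by
  ext b
  rw [PMF.bind_apply]
  have : ∀ a, p a * f a b = p a * q b := by
    intro a
    by_cases ha : a ∈ p.support
    · rw [h a ha]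
    · rw [PMF.mem_support_iff, not_not] at ha
      simp [ha]
  simp_rw [this, ENNReal.tsum_mul_right, PMF.tsum_coe, one_mul]

/-- The same `p` must serve for all answers. This suits the exploration, where the order in which
edges are found is random but has no effect on the output. -/
theorem realizes_query {S : Finset (Fin n × Fin n)} {x : Node n} {s : ℕ}
    {next : Option (Fin n) → QueryAlg n} {p : PMF ℚ} {c : ℕ}
    (h : ∀ a ∈ (answer w S x s).support, Realizes w (explore S x a) (next a) p c) :
    Realizes w S (.query x s next) p (c + 1) := by
  refine ⟨?_, fun o ho => ?_⟩
  · simp only [QueryAlg.runFrom, PMF.map_bind, PMF.map_comp]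
    exact PMF.bind_eq_of_forall_support fun a ha => (h a ha).1
  · simp only [QueryAlg.runFrom, PMF.mem_support_bind_iff, PMF.mem_support_map_iff] at ho
    obtain ⟨a, ha, o', ho', rfl⟩ := ho
    exact Nat.succ_le_succ ((h a ha).2 o' ho')

theorem Realizes.expectedQueries_le {A : QueryAlg n} {p : PMF ℚ} {c : ℕ}
    (h : Realizes w ∅ A p c) : A.expectedQueries w ≤ c := by
  calc A.expectedQueries w ≤ ∑' o : ℚ × ℕ, A.run w o * (c : ℝ≥0∞) := by
        refine ENNReal.tsum_le_tsum fun o => ?_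
        by_cases ho : o ∈ (A.run w).support
        · gcongr
          exact_mod_cast h.2 o ho
        · rw [PMF.mem_support_iff, not_not] at ho
          simp [ho]
    _ = c := by rw [ENNReal.tsum_mul_right, PMF.tsum_coe, one_mul]

theorem Realizes.probOutput_eq {A : QueryAlg n} {p : PMF ℚ} {c : ℕ}
    (h : Realizes w ∅ A p c) (P : ℚ → Prop) : A.probOutput w P = p.toOuterMeasure {κ | P κ} := by
  rw [← h.1, PMF.toOuterMeasure_map_apply]
  rfl

theorem mem_support_answer {S : Finset (Fin n × Fin n)} {x : Node n} {s : ℕ}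
    {a : Option (Fin n)} (ha : a ∈ (answer w S x s).support) :
    (a = none ∧ unexplored w S x s = ∅) ∨ ∃ z ∈ unexplored w S x s, a = some z := by
  unfold answer at ha
  split_ifs at ha with h
  · right
    rw [PMF.mem_support_map_iff] at ha
    obtain ⟨z, hz, rfl⟩ := ha
    exact ⟨z, (PMF.mem_support_uniformOfFinset_iff h z).1 hz, rfl⟩
  · left
    exact ⟨by simpa using ha, Finset.not_nonempty_iff_eq_empty.1 h⟩

end Semantics

/-! ### Learning balls by queries. -/

section Exploration

variable {n : ℕ}

/-- The edges of known weight, when `K e` is the weight of the edge `e` if it is known, and `0`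
otherwise. -/
def knownEdges (K : Fin n × Fin n → ℕ) : Finset (Fin n × Fin n) :=
  Finset.univ.filter fun e => K e ≠ 0

/-- Query the edges of weight `s` at `x`, at most `f` times, and continue with the new
knowledge. -/
def learn (x : Node n) (s : ℕ) : ℕ → (Fin n × Fin n → ℕ) →
    ((Fin n × Fin n → ℕ) → QueryAlg n) → QueryAlg n
  | 0, K, c => c K
  | f + 1, K, c => .query x s fun a =>
      a.elim (c K) fun z => learn x s f (Function.update K (edgeAt x z) s) c

/-- Learn the edges of weight `s` at `x` for all pairs `(x, s)` of a list. -/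
def learnAll (f : ℕ) : List (Node n × ℕ) → (Fin n × Fin n → ℕ) →
    ((Fin n × Fin n → ℕ) → QueryAlg n) → QueryAlg n
  | [], K, c => c K
  | q :: l, K, c => learn q.1 q.2 f K fun K' => learnAll f l K' c

/-- The nodes that are joined to `x` by an edge of known weight. -/
def knownNbrs (K : Fin n × Fin n → ℕ) (x : Node n) : List (Node n) :=
  ((List.finRange n).filter fun z => decide (K (edgeAt x z) ≠ 0)).map (farEnd x)

/-- Learn all edges with a weight in `T` at all nodes at distance less than `r` of the nodes of a
list, for the distance in the graph of the edges with a weight in `T`. -/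
def exploreBall (f : ℕ) (T : List ℕ) : ℕ → List (Node n) → (Fin n × Fin n → ℕ) →
    ((Fin n × Fin n → ℕ) → QueryAlg n) → QueryAlg n
  | 0, _, K, c => c K
  | r + 1, l, K, c => learnAll f (l ×ˢ T) K fun K' =>
      exploreBall f T r (l.flatMap (knownNbrs K')) K' c

/-- The known weights are correct, and belong to `T`. -/
def IsSound (w : Fin n × Fin n → ℕ) (T : List ℕ) (K : Fin n × Fin n → ℕ) : Prop :=
  ∀ e, K e ≠ 0 → K e = w e ∧ w e ∈ T

/-- All edges of weight `s` at `x` are known. -/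
def IsCompleteAt (w : Fin n × Fin n → ℕ) (K : Fin n × Fin n → ℕ) (x : Node n) (s : ℕ) : Prop :=
  ∀ z, w (edgeAt x z) = s → K (edgeAt x z) = s

/-- The knowledge `K'` extends the knowledge `K`. -/
def Extends (K K' : Fin n × Fin n → ℕ) : Prop :=
  ∀ e, K e ≠ 0 → K' e = K e

theorem Extends.trans {K K' K'' : Fin n × Fin n → ℕ} (h : Extends K K') (h' : Extends K' K'') :
    Extends K K'' := fun e he => by
  have h1 := h e he
  rw [h' e (by rwa [h1]), h1]

theorem IsCompleteAt.extends {w K K' : Fin n × Fin n → ℕ} {x : Node n} {s : ℕ} (hs : s ≠ 0)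
    (h : IsCompleteAt w K x s) (h' : Extends K K') : IsCompleteAt w K' x s := fun z hz => by
  have h1 := h z hz
  rw [h' _ (by rwa [h1]), h1]

/-- Each successful answer removes one of at most `f` unexplored nodes, so the queries end with
`none` or with nothing left; either way all edges of weight `s` at `x` are known. The explored set
stays equal to `knownEdges K`, which needs `s ≠ 0` because 0 encodes an unknown weight. -/
theorem realizes_learn {w : Fin n × Fin n → ℕ} {T : List ℕ} {x : Node n} {s : ℕ} {p : PMF ℚ}
    {C : ℕ} {c : (Fin n × Fin n → ℕ) → QueryAlg n} (hs : s ≠ 0) (hT : s ∈ T) (f : ℕ) :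
    ∀ {K : Fin n × Fin n → ℕ}, IsSound w T K → (unexplored w (knownEdges K) x s).card ≤ f →
      (∀ K', IsSound w T K' → Extends K K' → IsCompleteAt w K' x s →
        Realizes w (knownEdges K') (c K') p C) →
      Realizes w (knownEdges K) (learn x s f K c) p (C + f) := by
  have hcomplete : ∀ K, IsSound w T K → unexplored w (knownEdges K) x s = ∅ →
      IsCompleteAt w K x s := by
    intro K hK h0 z hz
    have : z ∉ unexplored w (knownEdges K) x s := by simp [h0]
    simp only [unexplored, knownEdges, Finset.mem_filter, Finset.mem_univ, true_and, not_and,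
      not_not] at this
    rw [(hK _ (this hz)).1, hz]
  induction f with
  | zero =>
    intro K hK hcard hc
    exact hc K hK (fun _ _ => rfl)
      (hcomplete K hK (Finset.card_eq_zero.1 (Nat.le_zero.1 hcard)))
  | succ f ih =>
    intro K hK hcard hc
    refine realizes_query (c := C + f) fun a ha => ?_
    rcases mem_support_answer ha with ⟨rfl, h0⟩ | ⟨z, hz, rfl⟩
    · exact (hc K hK (fun _ _ => rfl) (hcomplete K hK h0)).mono (by omega)
    · have hz' := hz
      simp only [unexplored, knownEdges, Finset.mem_filter, Finset.mem_univ, true_and,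
        not_not] at hz'
      set K₁ := Function.update K (edgeAt x z) s with hK₁
      have hS : explore (knownEdges K) x (some z) = knownEdges K₁ := by
        ext e
        by_cases he : e = edgeAt x z
        · simp [explore, knownEdges, hK₁, he, hs]
        · simp [explore, knownEdges, hK₁, he]
      have hsound : IsSound w T K₁ := by
        intro e he
        by_cases hee : e = edgeAt x z
        · subst hee
          simp [hK₁, hz'.1, hT]
        · rw [hK₁, Function.update_of_ne hee] at he ⊢
          exact hK e he
      have hext : Extends K K₁ := by
        intro e he
        have hee : e ≠ edgeAt x z := by
          rintro rfl
          exact he hz'.2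
        rw [hK₁, Function.update_of_ne hee]
      rw [hS]
      refine ih hsound ?_ fun K' h1 h2 h3 => hc K' h1 (hext.trans h2) h3
      have hlt : (unexplored w (knownEdges K₁) x s).card <
          (unexplored w (knownEdges K) x s).card := by
        refine Finset.card_lt_card (Finset.ssubset_iff_of_subset ?_ |>.2 ⟨z, hz, ?_⟩)
        · intro y hy
          simp only [unexplored, knownEdges, Finset.mem_filter, Finset.mem_univ, true_and,
            not_not] at hy ⊢
          refine ⟨hy.1, by_contra fun h => ?_⟩
          have := hext _ h
          exact h (this ▸ hy.2)
        · simp [unexplored, knownEdges, hK₁, hs]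
      omega

theorem card_unexplored_le (w : Fin n × Fin n → ℕ) (S : Finset (Fin n × Fin n)) (x : Node n)
    (s : ℕ) : (unexplored w S x s).card ≤ weightDegree w s x :=
  Finset.card_le_card (Finset.monotone_filter_right _ fun _ _ h => h.1)

theorem realizes_learnAll {w : Fin n × Fin n → ℕ} {T : List ℕ} {p : PMF ℚ}
    {C f : ℕ} {c : (Fin n × Fin n → ℕ) → QueryAlg n} (h0 : 0 ∉ T)
    (hf : ∀ s ∈ T, ∀ x, weightDegree w s x ≤ f) (l : List (Node n × ℕ)) :
    ∀ {K : Fin n × Fin n → ℕ}, (∀ q ∈ l, q.2 ∈ T) → IsSound w T K →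
      (∀ K', IsSound w T K' → Extends K K' → (∀ q ∈ l, IsCompleteAt w K' q.1 q.2) →
        Realizes w (knownEdges K') (c K') p C) →
      Realizes w (knownEdges K) (learnAll f l K c) p (C + l.length * f) := by
  induction l with
  | nil =>
    intro K _ hK hc
    simpa [learnAll] using hc K hK (fun _ _ => rfl) (by simp)
  | cons q l ih =>
    intro K hl hK hc
    have hq : q.2 ∈ T := hl q (by simp)
    have hq0 : q.2 ≠ 0 := fun h => h0 (h ▸ hq)
    have := realizes_learn (C := C + l.length * f) (c := fun K' => learnAll f l K' c) hq0 hq f hK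
      ((card_unexplored_le w _ _ _).trans (hf _ hq _)) fun K' h1 h2 h3 =>
        ih (fun q' hq' => hl q' (by simp [hq'])) h1 fun K'' h4 h5 h6 =>
          hc K'' h4 (h2.trans h5) fun q' hq' => by
            rcases List.mem_cons.1 hq' with rfl | hq'
            · exact h3.extends hq0 h5
            · exact h6 q' hq'
    refine Realizes.mono this (le_of_eq ?_)
    simp only [List.length_cons]
    ring

/-- The saving on an edge of weight at most three, compared with weight three, if only the weights
in `T` are taken into account. -/
def saving (T : List ℕ) (w : Fin n × Fin n → ℕ) (e : Fin n × Fin n) : ℕ :=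
  if w e ∈ T then 3 - w e else 0

/-- Bounds both the branching of the exploration and the degree `Δ` in the auction. -/
theorem card_filter_weight_mem_le {w : Fin n × Fin n → ℕ} {T : List ℕ} {f : ℕ}
    (hf : ∀ s ∈ T, ∀ x, weightDegree w s x ≤ f) (x : Node n) :
    (Finset.univ.filter fun z => w (edgeAt x z) ∈ T).card ≤ T.length * f := by
  have h : (Finset.univ.filter fun z => w (edgeAt x z) ∈ T) =
      T.toFinset.biUnion fun s => Finset.univ.filter fun z => w (edgeAt x z) = s := by
    ext z
    simp
  rw [h]
  refine (Finset.card_biUnion_le_card_mul _ _ f fun s hs => ?_).trans ?_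
  · exact hf s (List.mem_toFinset.1 hs) x
  · exact Nat.mul_le_mul_right _ (List.toFinset_card_le T)

theorem length_knownNbrs_le {w K : Fin n × Fin n → ℕ} {T : List ℕ} {f : ℕ}
    (hf : ∀ s ∈ T, ∀ x, weightDegree w s x ≤ f) (hK : IsSound w T K) (x : Node n) :
    (knownNbrs K x).length ≤ T.length * f := by
  refine le_trans ?_ (card_filter_weight_mem_le hf x)
  unfold knownNbrs
  rw [List.length_map, ← List.toFinset_card_of_nodup ((List.nodup_finRange n).filter _)]
  refine Finset.card_le_card fun z hz => ?_
  simp only [List.mem_toFinset, List.mem_filter, decide_eq_true_eq] at hz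
  simp [(hK _ hz.2).2]

theorem farEnd_mem_knownNbrs {K : Fin n × Fin n → ℕ} {x : Node n} {z : Fin n}
    (h : K (edgeAt x z) ≠ 0) : farEnd x z ∈ knownNbrs K x :=
  List.mem_map_of_mem (List.mem_filter.2 ⟨List.mem_finRange z, by simpa using h⟩)

/-- A bound for the number of queries of the exploration with radius `r` around `m` nodes, if
every node has at most `b` edges to be found. -/
def ballCost (b : ℕ) : ℕ → ℕ → ℕ
  | 0, _ => 0
  | r + 1, m => ballCost b r (m * b) + m * b

theorem ballCost_mono (b r : ℕ) : Monotone (ballCost b r) := by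
  induction r with
  | zero => exact fun _ _ _ => le_rfl
  | succ r ih =>
    intro m m' h
    have h' := Nat.mul_le_mul_right b h
    exact Nat.add_le_add (ih h') h'

theorem length_flatMap_le {α β : Type*} {g : α → List β} {b : ℕ} (hg : ∀ a, (g a).length ≤ b)
    (l : List α) : (l.flatMap g).length ≤ l.length * b := by
  induction l with
  | nil => simp
  | cons a l ih =>
    have := hg a
    simp only [List.flatMap_cons, List.length_append, List.length_cons, Nat.succ_mul]
    omega

/-- After the queries at `l`, the known neighbours include all neighbours along edges with weights
in `T`, so the induction continues from them, and later knowledge only extends. An unknown edge has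
`K = 0 ∉ T`, hence saving zero. -/
theorem realizes_exploreBall {w : Fin n × Fin n → ℕ} {T : List ℕ} {p : PMF ℚ}
    {f : ℕ} {c : (Fin n × Fin n → ℕ) → QueryAlg n} (h0 : 0 ∉ T)
    (hf : ∀ s ∈ T, ∀ x, weightDegree w s x ≤ f) (r : ℕ) :
    ∀ {l : List (Node n)} {K : Fin n × Fin n → ℕ}, IsSound w T K →
      (∀ K', IsSound w T K' → Extends K K' →
        (∀ x ∈ l, AgreeWithin (saving T w) (saving T K') r x) →
        Realizes w (knownEdges K') (c K') p 0) →
      Realizes w (knownEdges K) (exploreBall f T r l K c) p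
        (ballCost (T.length * f) r l.length) := by
  induction r with
  | zero => exact fun hK hc => hc _ hK (fun _ _ => rfl) fun _ _ => trivial
  | succ r ih =>
    intro l K hK hc
    refine Realizes.mono (realizes_learnAll (C := ballCost (T.length * f) r
      (l.length * (T.length * f))) h0 hf (l ×ˢ T) (fun q hq => ?_) hK
      fun K' h1 h2 h3 => ?_) (le_of_eq ?_)
    · exact (List.mem_product.1 hq).2
    · refine Realizes.mono (ih h1 fun K'' h4 h5 h6 => hc K'' h4 (h2.trans h5) fun x hx => ?_)
        (ballCost_mono _ _ (length_flatMap_le (length_knownNbrs_le hf h1) l))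
      have hk : ∀ z, w (edgeAt x z) ∈ T → K' (edgeAt x z) = w (edgeAt x z) := fun z hz =>
        h3 (x, w (edgeAt x z)) (List.mem_product.2 ⟨hx, hz⟩) z rfl
      have hne : ∀ z, w (edgeAt x z) ∈ T → K' (edgeAt x z) ≠ 0 := fun z hz h => by
        rw [hk z hz] at h
        exact h0 (h ▸ hz)
      refine ⟨fun z => ?_, fun z hz => h6 _ (List.mem_flatMap.2 ⟨x, hx, ?_⟩)⟩
      · unfold saving
        by_cases hz : w (edgeAt x z) ∈ T
        · rw [h5 _ (hne z hz), hk z hz]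
        · rw [if_neg hz, if_neg]
          intro hz'
          have hz0 : K'' (edgeAt x z) ≠ 0 := fun h => h0 (h ▸ hz')
          exact hz (h4 _ hz0).2
      · refine farEnd_mem_knownNbrs (hne z ?_)
        by_contra hzT
        exact hz (if_neg hzT)
    · rw [List.length_product, ballCost]
      ring

end Exploration

/-! ### Earth mover's distance and matchings of `H`. -/

section EarthMover

variable {V : Type*} [Fintype V] [DecidableEq V] (G : SimpleGraph V) [DecidableRel G.Adj]

theorem mem_closedNbr {x y : V} : y ∈ closedNbr G x ↔ y = x ∨ G.Adj x y := by
  simp [closedNbr]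

theorem mem_privateNbr {u v x : V} :
    x ∈ privateNbr G u v ↔ G.Adj u x ∧ ¬ G.Adj v x ∧ x ≠ v := by
  simp [privateNbr, and_comm]

theorem card_closedNbr (x : V) : (closedNbr G x).card = 1 + G.degree x := by
  rw [closedNbr, Finset.card_insert_of_notMem (by simp), add_comm, SimpleGraph.card_neighborFinset_eq_degree]

theorem closedNbr_sdiff {u v : V} (huv : G.Adj u v) :
    closedNbr G u \ closedNbr G v = privateNbr G u v := by
  ext x
  rw [Finset.mem_sdiff, mem_closedNbr, mem_closedNbr, mem_privateNbr]
  constructor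
  · rintro ⟨rfl | h1, h2⟩
    · exact absurd (Or.inr huv.symm) h2
    · exact ⟨h1, fun h => h2 (Or.inr h), fun h => h2 (Or.inl h)⟩
  · rintro ⟨h1, h2, h3⟩
    exact ⟨Or.inr h1, fun h => h.elim h3 h2⟩

theorem sum_closedNbr {u v : V} (huv : G.Adj u v) (g : V → ℝ) :
    ∑ x ∈ closedNbr G u, g x =
      ∑ x ∈ closedNbr G u ∩ closedNbr G v, g x + ∑ x ∈ privateNbr G u v, g x := by
  rw [← closedNbr_sdiff G huv, Finset.sum_inter_add_sum_sdiff]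

theorem sum_privateNbr {u v : V} {n : ℕ} (eL : Fin n ≃ privateNbr G u v) (g : V → ℝ) :
    ∑ x ∈ privateNbr G u v, g x = ∑ i, g (eL i) := by
  rw [← Finset.sum_coe_sort, ← Equiv.sum_comp eL]

theorem card_le_degree {u v : V} {n : ℕ} (eL : Fin n ≃ privateNbr G u v) : n ≤ G.degree u := by
  have h := Fintype.card_congr eL
  rw [Fintype.card_fin, Fintype.card_coe] at h
  rw [h, ← SimpleGraph.card_neighborFinset_eq_degree]
  exact Finset.card_le_card Finset.sdiff_subset

theorem reachable_of_mem_closedNbr {x y : V} (h : y ∈ closedNbr G x) : G.Reachable x y := by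
  rcases (mem_closedNbr G).1 h with rfl | h
  · exact SimpleGraph.Reachable.refl _
  · exact h.reachable

variable {G} {u v : V} {n : ℕ}

theorem hWeight_le (huv : G.Adj u v) (eL : Fin n ≃ privateNbr G u v)
    (eR : Fin n ≃ privateNbr G v u) (e : Fin n × Fin n) : hWeight G eL eR e ≤ 3 := by
  have hi := ((mem_privateNbr G).1 (eL e.1).2).1
  have hj := ((mem_privateNbr G).1 (eR e.2).2).1
  exact SimpleGraph.dist_le (.cons hi.symm (.cons huv (.cons hj .nil)))

theorem one_le_hWeight (huv : G.Adj u v) (eL : Fin n ≃ privateNbr G u v)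
    (eR : Fin n ≃ privateNbr G v u) (e : Fin n × Fin n) : 1 ≤ hWeight G eL eR e := by
  have hi := (mem_privateNbr G).1 (eL e.1).2
  have hj := (mem_privateNbr G).1 (eR e.2).2
  refine SimpleGraph.Reachable.pos_dist_of_ne
    ((hi.1.symm.reachable.trans huv.reachable).trans hj.1.reachable) fun h => ?_
  exact hi.2.1 (h ▸ hj.1)

/-- A perfect matching of the bipartite graph `H` gives a transport plan that leaves the mass on
the common neighbours in place. -/
theorem exists_isTransportPlan (huv : G.Adj u v) (hdeg : G.degree u = G.degree v)
    (eL : Fin n ≃ privateNbr G u v) (eR : Fin n ≃ privateNbr G v u) (σ : Equiv.Perm (Fin n)) :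
    ∃ z : V → V → ℝ, IsTransportPlan (closedNbr G u) (closedNbr G v)
      (fun _ => 1 / (1 + (G.degree u : ℝ))) (fun _ => 1 / (1 + (G.degree v : ℝ))) z ∧
      ∑ x ∈ closedNbr G u, ∑ y ∈ closedNbr G v, (G.dist x y : ℝ) * z x y =
        (∑ i, (hWeight G eL eR (i, σ i) : ℝ)) / (1 + G.degree u) := by
  set A := closedNbr G u with hA
  set B := closedNbr G v with hB
  set c : ℝ := 1 / (1 + (G.degree u : ℝ)) with hc
  let π : V → V := fun x =>
    if h : x ∈ privateNbr G u v then (eR (σ (eL.symm ⟨x, h⟩)) : V) else x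
  have hL : ∀ x ∈ A, x ∉ B → x ∈ privateNbr G u v := fun x h1 h2 => by
    rw [← closedNbr_sdiff G huv]; exact Finset.mem_sdiff.2 ⟨h1, h2⟩
  have hL' : ∀ x, x ∈ privateNbr G u v → x ∉ B := fun x h => by
    rw [← closedNbr_sdiff G huv] at h; exact (Finset.mem_sdiff.1 h).2
  have hR : ∀ x, x ∈ privateNbr G v u → x ∈ B ∧ x ∉ A := fun x h => by
    rw [← closedNbr_sdiff G huv.symm] at h; exact Finset.mem_sdiff.1 h
  have hπL : ∀ x (h : x ∈ privateNbr G u v), π x = eR (σ (eL.symm ⟨x, h⟩)) := fun x h => dif_pos h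
  have hπC : ∀ x, x ∉ privateNbr G u v → π x = x := fun x h => dif_neg h
  have hmaps : ∀ x ∈ A, π x ∈ B := by
    intro x hx
    by_cases h : x ∈ privateNbr G u v
    · rw [hπL x h]; exact (hR _ (eR _).2).1
    · rw [hπC x h]; by_contra h'; exact h (hL x hx h')
  have hinj : Set.InjOn π A := by
    intro x hx y hy hxy
    by_cases h : x ∈ privateNbr G u v <;> by_cases h' : y ∈ privateNbr G u v
    · rw [hπL x h, hπL y h'] at hxy
      simpa using hxy
    · rw [hπL x h, hπC y h'] at hxy
      exact absurd hy (hxy ▸ (hR _ (eR _).2).2)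
    · rw [hπC x h, hπL y h'] at hxy
      exact absurd hx (hxy ▸ (hR _ (eR _).2).2)
    · rwa [hπC x h, hπC y h'] at hxy
  have hsurj : Set.SurjOn π A B := Finset.surjOn_of_injOn_of_card_le π hmaps hinj (by
    rw [hA, hB, card_closedNbr, card_closedNbr, hdeg])
  refine ⟨fun x y => if π x = y then c else 0, ⟨fun x hx => ?_, fun y hy => ?_, fun x _ y _ => ?_⟩,
    ?_⟩
  · rw [Finset.sum_ite_eq, if_pos (hmaps x hx)]
  · obtain ⟨x, hx, rfl⟩ := hsurj hy
    rw [Finset.sum_eq_single x]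
    · simp [hc, hdeg]
    · intro x' hx' hne
      exact if_neg fun h => hne (hinj hx' hx h)
    · exact fun h => absurd hx h
  · dsimp only
    split_ifs
    · positivity
    · exact le_rfl
  · have h1 : ∀ x ∈ A, (∑ y ∈ B, (G.dist x y : ℝ) * if π x = y then c else 0) =
        G.dist x (π x) * c := by
      intro x hx
      simp only [mul_ite, mul_zero]
      rw [Finset.sum_ite_eq, if_pos (hmaps x hx)]
    rw [Finset.sum_congr rfl h1, sum_closedNbr G huv, Finset.sum_eq_zero, zero_add,
      sum_privateNbr G eL, ← Finset.sum_mul, hc, mul_one_div]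
    · congr 1
      refine Finset.sum_congr rfl fun i _ => ?_
      rw [hπL _ (eL i).2]
      simp [hWeight]
    · intro x hx
      rw [hπC x fun h => hL' x h (Finset.mem_inter.1 hx).2]
      simp

theorem edgeEmd_le (huv : G.Adj u v) (hdeg : G.degree u = G.degree v)
    (eL : Fin n ≃ privateNbr G u v) (eR : Fin n ≃ privateNbr G v u) (σ : Equiv.Perm (Fin n)) :
    edgeEmd G u v ≤ (∑ i, (hWeight G eL eR (i, σ i) : ℝ)) / (1 + G.degree u) := by
  obtain ⟨z, hz, hcost⟩ := exists_isTransportPlan huv hdeg eL eR σ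
  refine csInf_le ⟨0, ?_⟩ ⟨z, hz, hcost.symm⟩
  rintro _ ⟨z, hz, rfl⟩
  exact Finset.sum_nonneg fun x hx => Finset.sum_nonneg fun y hy =>
    mul_nonneg (Nat.cast_nonneg _) (hz.2.2 x hx y hy)

/-- Weak duality: potentials that are feasible for the bipartite graph `H` give a lower bound for
the earth mover's distance. -/
theorem le_edgeEmd (huv : G.Adj u v) (hdeg : G.degree u = G.degree v)
    (eL : Fin n ≃ privateNbr G u v) (eR : Fin n ≃ privateNbr G v u) {a b : Fin n → ℝ}
    (hab : ∀ i j, a i + b j ≤ hWeight G eL eR (i, j)) :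
    (∑ i, a i + ∑ j, b j) / (1 + G.degree u) ≤ edgeEmd G u v := by
  obtain ⟨z₀, hz₀, -⟩ := exists_isTransportPlan huv hdeg eL eR 1
  refine le_csInf ⟨_, z₀, hz₀, rfl⟩ ?_
  rintro _ ⟨z, hz, rfl⟩
  -- `G` may be disconnected, and `dist` is 0 between components, so the triangle inequality needs
  -- reachability.
  have hreach : ∀ x ∈ closedNbr G u, ∀ y ∈ closedNbr G v, G.Reachable x y := fun x hx y hy =>
    ((reachable_of_mem_closedNbr G hx).symm.trans huv.reachable).trans
      (reachable_of_mem_closedNbr G hy)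
  rcases n with _ | n
  · simp only [Finset.univ_eq_empty, Finset.sum_empty, add_zero, zero_div]
    exact Finset.sum_nonneg fun x hx => Finset.sum_nonneg fun y hy =>
      mul_nonneg (Nat.cast_nonneg _) (hz.2.2 x hx y hy)
  -- A McShane extension: `f` is 1-Lipschitz on the pairs that matter, at most `-a` on `L` and, by
  -- feasibility, at least `b` on `R`. Being a single function, it cancels on the common neighbours.
  let f : V → ℝ := fun y =>
    Finset.univ.inf' Finset.univ_nonempty fun i => (G.dist (eL i : V) y : ℝ) - a i
  have hlip : ∀ x ∈ closedNbr G u, ∀ y ∈ closedNbr G v, f y - f x ≤ G.dist x y := by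
    intro x hx y hy
    obtain ⟨i, -, hi⟩ := Finset.exists_mem_eq_inf' Finset.univ_nonempty
      fun i => (G.dist (eL i : V) x : ℝ) - a i
    have h1 : f x = (G.dist (eL i : V) x : ℝ) - a i := hi
    have h2 : f y ≤ (G.dist (eL i : V) y : ℝ) - a i := Finset.inf'_le _ (Finset.mem_univ i)
    have h3 : (G.dist (eL i : V) y : ℝ) ≤ G.dist (eL i : V) x + G.dist x y := by
      exact_mod_cast (hreach x hx y hy).dist_triangle_right _
    linarith
  have hL : ∀ i, a i ≤ - f (eL i) := by
    intro i
    have : f (eL i) ≤ (G.dist (eL i : V) (eL i) : ℝ) - a i := Finset.inf'_le _ (Finset.mem_univ i)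
    simp only [SimpleGraph.dist_self, Nat.cast_zero] at this
    linarith
  have hR : ∀ j, b j ≤ f (eR j) := by
    intro j
    refine Finset.le_inf' _ _ fun i _ => ?_
    have := hab i j
    simp only [hWeight] at this
    linarith
  have hcost : ∑ x ∈ closedNbr G u, ∑ y ∈ closedNbr G v, (f y - f x) * z x y ≤
      ∑ x ∈ closedNbr G u, ∑ y ∈ closedNbr G v, (G.dist x y : ℝ) * z x y :=
    Finset.sum_le_sum fun x hx => Finset.sum_le_sum fun y hy =>
      mul_le_mul_of_nonneg_right (hlip x hx y hy) (hz.2.2 x hx y hy)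
  refine le_trans (le_of_le_of_eq (b := (∑ y ∈ closedNbr G v, f y - ∑ x ∈ closedNbr G u, f x) *
    (1 / (1 + (G.degree u : ℝ)))) ?_ ?_) hcost
  · rw [div_eq_mul_one_div]
    refine mul_le_mul_of_nonneg_right ?_ (by positivity)
    rw [sum_closedNbr G huv, sum_closedNbr G huv.symm, Finset.inter_comm, sum_privateNbr G eL,
      sum_privateNbr G eR]
    have h1 := Finset.sum_le_sum fun i (_ : i ∈ Finset.univ) => hL i
    have h2 := Finset.sum_le_sum fun i (_ : i ∈ Finset.univ) => hR i
    rw [Finset.sum_neg_distrib] at h1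
    linarith
  · simp only [sub_mul, Finset.sum_sub_distrib]
    rw [Finset.sum_comm]
    simp only [← Finset.mul_sum]
    have hB : ∀ y ∈ closedNbr G v, f y * ∑ x ∈ closedNbr G u, z x y =
        f y * (1 / (1 + (G.degree u : ℝ))) := fun y hy => by rw [hz.2.1 y hy, hdeg]
    have hA : ∀ x ∈ closedNbr G u, f x * ∑ y ∈ closedNbr G v, z x y =
        f x * (1 / (1 + (G.degree u : ℝ))) := fun x hx => by rw [hz.1 x hx]
    rw [Finset.sum_congr rfl hB, Finset.sum_congr rfl hA, ← Finset.sum_mul, ← Finset.sum_mul]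

/-- The owners form a partial matching, which extends to a permutation; the added edges cost at most
3 each. -/
theorem edgeEmd_mul_le (huv : G.Adj u v) (hdeg : G.degree u = G.degree v)
    (eL : Fin n ≃ privateNbr G u v) (eR : Fin n ≃ privateNbr G v u) (T : List ℕ) (M t : ℕ) :
    edgeEmd G u v * (1 + G.degree u) ≤ 3 * n -
      ∑ j, (ownerProfit (saving T (hWeight G eL eR))
        (auction M (saving T (hWeight G eL eR)) t) j : ℝ) := by
  set w := hWeight G eL eR
  set φ := saving T w with hφ
  have hφ3 : ∀ e, w e + φ e ≤ 3 := fun e => by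
    have : w e ≤ 3 := hWeight_le huv eL eR e
    simp only [hφ, saving]
    split_ifs <;> omega
  set st := auction M φ t
  have hinv : AuctionInvariant M 3 φ st :=
    auctionInvariant_auction M (fun e => (Nat.le_add_left _ _).trans (hφ3 e)) t
  obtain ⟨σ, hσ⟩ : ∃ σ : Equiv.Perm (Fin n), ∀ i j, st.owner j = some i → σ j = i := by
    let f : Fin n → Fin n := fun j => (st.owner j).getD j
    obtain ⟨g, hg⟩ := Set.MapsTo.exists_equiv_extend_of_card_eq (t := (Finset.univ : Finset (Fin n)))
      (by simp) (s := {j | st.owner j ≠ none}) (f := f) (fun _ _ => by simp) (by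
        intro j hj k hk hjk
        obtain ⟨i, hi⟩ := Option.ne_none_iff_exists'.1 hj
        obtain ⟨i', hi'⟩ := Option.ne_none_iff_exists'.1 hk
        simp only [f, hi, hi', Option.getD_some] at hjk
        exact hinv.injective i j k hi (hjk ▸ hi'))
    refine ⟨g.trans (Equiv.subtypeUnivEquiv Finset.mem_univ), fun i j hij => ?_⟩
    have := hg j (by simp [hij])
    simpa [f, hij] using this
  -- `σ` sends objects to bidders, the transport plan bidders to objects.
  have h := edgeEmd_le huv hdeg eL eR σ⁻¹
  have hD : (0 : ℝ) < 1 + G.degree u := by positivity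
  rw [le_div_iff₀ hD] at h
  refine h.trans ?_
  rw [← Equiv.sum_comp σ, le_sub_iff_add_le, ← Finset.sum_add_distrib]
  refine (Finset.sum_le_card_nsmul _ _ 3 fun j _ => ?_).trans (by simp [mul_comm])
  simp only [Equiv.Perm.inv_def, Equiv.symm_apply_apply]
  have : ownerProfit φ st j ≤ φ (σ j, j) := by
    unfold ownerProfit
    cases ho : st.owner j with
    | none => simp
    | some i => simp [hσ i j ho]
  exact_mod_cast (Nat.add_le_add_left this _).trans (hφ3 (σ j, j))

/-- Weak duality for the potentials `c - utility / M` and `-price / M`, which are feasible because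
`c` is at most weight plus saving. -/
theorem le_edgeEmd_mul (huv : G.Adj u v) (hdeg : G.degree u = G.degree v)
    (eL : Fin n ≃ privateNbr G u v) (eR : Fin n ≃ privateNbr G v u) {T : List ℕ} {M c : ℕ}
    (hM : 0 < M) (hc : ∀ e, c ≤ hWeight G eL eR e + saving T (hWeight G eL eR) e) (t : ℕ) :
    (M * c : ℝ) * n ≤ M * (edgeEmd G u v * (1 + G.degree u)) +
      M * ∑ j, (ownerProfit (saving T (hWeight G eL eR))
        (auction M (saving T (hWeight G eL eR)) t) j : ℝ) + n +
      M * 3 * (activeBidders M (saving T (hWeight G eL eR))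
        (auction M (saving T (hWeight G eL eR)) t)).card := by
  set w := hWeight G eL eR
  set φ := saving T w with hφ
  have hφ3 : ∀ e, φ e ≤ 3 := fun e => by
    simp only [hφ, saving]
    split_ifs <;> omega
  set st := auction M φ t
  have hM' : (0 : ℝ) < M := by exact_mod_cast hM
  have hsum : (∑ i, (utility M φ st i : ℝ) + ∑ j, (st.price j : ℝ)) ≤
      M * ∑ j, (ownerProfit φ st j : ℝ) + n + M * 3 * (activeBidders M φ st).card := by
    exact_mod_cast (auctionInvariant_auction M hφ3 t).sum_le hφ3
  have h := le_edgeEmd huv hdeg eL eR (a := fun i => c - (utility M φ st i : ℝ) / M)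
    (b := fun j => - ((st.price j : ℝ) / M)) (by
      intro i j
      have h1 : M * φ (i, j) ≤ utility M φ st i + st.price j := by
        have := netValue_le_utility M φ st i j
        unfold netValue at this
        omega
      have h2 : (M : ℝ) * φ (i, j) ≤ utility M φ st i + st.price j := by exact_mod_cast h1
      have h3 : (c : ℝ) ≤ w (i, j) + φ (i, j) := by exact_mod_cast hc (i, j)
      have h4 : (φ (i, j) : ℝ) ≤ (utility M φ st i : ℝ) / M + (st.price j : ℝ) / M := by
        rw [← add_div, le_div_iff₀ hM']
        linarith
      linarith)
  have hD : (0 : ℝ) < 1 + G.degree u := by positivity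
  rw [div_le_iff₀ hD] at h
  simp only [Finset.sum_sub_distrib, Finset.sum_neg_distrib, ← Finset.sum_div, Finset.sum_const,
    Finset.card_univ, Fintype.card_fin, nsmul_eq_mul] at h
  have h5 := mul_le_mul_of_nonneg_left h hM'.le
  have h6 : (M : ℝ) * (n * c - (∑ i, (utility M φ st i : ℝ)) / M +
      -((∑ j, (st.price j : ℝ)) / M)) =
      M * c * n - (∑ i, (utility M φ st i : ℝ) + ∑ j, (st.price j : ℝ)) := by
    field_simp
    ring
  linarith

end EarthMover

/-! ### Chebyshev's inequality by counting. -/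

section Sampling

/-- The second moment of a sum of `k` independent uniform samples of a function of mean zero. -/
theorem sum_sq_sum_samples {ι : Type*} [Fintype ι] {h : ι → ℝ} (h0 : ∑ a, h a = 0) (k : ℕ) :
    (Fintype.card ι : ℝ) * ∑ t : Fin k → ι, (∑ i, h (t i)) ^ 2 =
      k * (Fintype.card ι : ℝ) ^ k * ∑ a, h a ^ 2 := by
  induction k with
  | zero => simp
  | succ k ih =>
    rw [← (Fin.consEquiv fun _ => ι).sum_comp, Fintype.sum_prod_type]
    -- The cross term vanishes on summation over `a`, by `h0`.
    have h1 : ∀ (a : ι) (t : Fin k → ι),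
        (∑ i, h ((Fin.consEquiv fun _ => ι) (a, t) i)) ^ 2 =
          h a ^ 2 + 2 * h a * ∑ i, h (t i) + (∑ i, h (t i)) ^ 2 := by
      intro a t
      simp only [Fin.consEquiv_apply, Fin.sum_univ_succ, Fin.cons_zero, Fin.cons_succ]
      ring
    simp only [h1, Finset.sum_add_distrib, Finset.sum_const, ← Finset.mul_sum, ← Finset.sum_mul,
      h0, Finset.card_univ, nsmul_eq_mul, mul_zero, zero_mul, add_zero, Fintype.card_fun,
      Fintype.card_fin]
    push_cast
    rw [mul_add, ih]
    ring

/-- Chebyshev's inequality for the average of `k` independent uniform samples. -/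
theorem card_filter_deviation_le {n : ℕ} {g : Fin n → ℝ} {B δ : ℝ} (hδ : 0 < δ)
    (hg : ∀ a, 0 ≤ g a ∧ g a ≤ B) {k : ℕ} (hk : 0 < k) :
    ((Finset.univ.filter fun t : Fin k → Fin n =>
      δ * n < |n * (∑ i, g (t i)) / k - ∑ a, g a|).card : ℝ) * (δ ^ 2 * k) ≤
      B ^ 2 * (n : ℝ) ^ k := by
  rcases Nat.eq_zero_or_pos n with rfl | hn
  · have : IsEmpty (Fin k → Fin 0) := ⟨fun t => (t ⟨0, hk⟩).elim0⟩
    simp [Finset.univ_eq_empty, hk.ne']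
  have hn' : (0 : ℝ) < n := by exact_mod_cast hn
  have hk' : (0 : ℝ) < k := by exact_mod_cast hk
  set μ : ℝ := (∑ a, g a) / n with hμ
  have hμ0 : 0 ≤ μ := div_nonneg (Finset.sum_nonneg fun a _ => (hg a).1) hn'.le
  have hμB : μ ≤ B := by
    rw [hμ, div_le_iff₀ hn']
    refine (Finset.sum_le_card_nsmul _ _ B fun a _ => (hg a).2).trans ?_
    simp [mul_comm]
  have hmean : ∑ a, (g a - μ) = 0 := by
    rw [Finset.sum_sub_distrib, Finset.sum_const, Finset.card_univ, Fintype.card_fin,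
      nsmul_eq_mul, hμ]
    field_simp
    ring
  have hvar := sum_sq_sum_samples hmean k
  rw [Fintype.card_fin] at hvar
  have hsq : ∑ a, (g a - μ) ^ 2 ≤ n * B ^ 2 := by
    refine (Finset.sum_le_card_nsmul _ _ (B ^ 2) fun a _ => ?_).trans (by simp)
    refine sq_le_sq' ?_ ?_ <;> linarith [(hg a).1, (hg a).2]
  set bad := Finset.univ.filter fun t : Fin k → Fin n =>
    δ * n < |n * (∑ i, g (t i)) / k - ∑ a, g a| with hbad
  have hmarkov : (bad.card : ℝ) * (δ * k) ^ 2 ≤ ∑ t : Fin k → Fin n, (∑ i, (g (t i) - μ)) ^ 2 := by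
    calc (bad.card : ℝ) * (δ * k) ^ 2 = ∑ t ∈ bad, (δ * k) ^ 2 := by simp
      _ ≤ ∑ t ∈ bad, (∑ i, (g (t i) - μ)) ^ 2 := by
        refine Finset.sum_le_sum fun t ht => ?_
        rw [hbad, Finset.mem_filter] at ht
        have e : n * (∑ i, g (t i)) / k - ∑ a, g a = n / k * ∑ i, (g (t i) - μ) := by
          rw [Finset.sum_sub_distrib, Finset.sum_const, Finset.card_univ, Fintype.card_fin,
            nsmul_eq_mul, hμ]
          field_simp
        have h1 := ht.2
        rw [e, abs_mul, abs_of_pos (div_pos hn' hk'), div_mul_eq_mul_div, lt_div_iff₀ hk'] at h1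
        have h2 : δ * k ≤ |∑ i, (g (t i) - μ)| := by
          refine le_of_mul_le_mul_left ?_ hn'
          linarith
        rw [← sq_abs (∑ i, (g (t i) - μ))]
        exact pow_le_pow_left₀ (by positivity) h2 2
      _ ≤ _ := Finset.sum_le_univ_sum_of_nonneg fun t => sq_nonneg _
  refine le_of_mul_le_mul_left ?_ (mul_pos hn' hk')
  calc n * k * (bad.card * (δ ^ 2 * k)) = n * (bad.card * (δ * k) ^ 2) := by ring
    _ ≤ n * ∑ t : Fin k → Fin n, (∑ i, (g (t i) - μ)) ^ 2 :=
        mul_le_mul_of_nonneg_left hmarkov hn'.le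
    _ = k * n ^ k * ∑ a, (g a - μ) ^ 2 := hvar
    _ ≤ k * n ^ k * (n * B ^ 2) := mul_le_mul_of_nonneg_left hsq (by positivity)
    _ = n * k * (B ^ 2 * n ^ k) := by ring

/-- A property that fails for few of the values `F a` holds with high probability for a uniformly
random `a`. -/
theorem le_toOuterMeasure_uniform_bind {N : ℕ} {α : Type*} [Fintype α] (e : Fin (N + 1) ≃ α)
    (F : α → ℚ) (P : ℚ → Prop) [DecidablePred P] {η : ℝ}
    (h : ((Finset.univ.filter fun t => ¬ P (F t)).card : ℝ) ≤ η * Fintype.card α) :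
    ENNReal.ofReal (1 - η) ≤ ((PMF.uniformOfFintype (Fin (N + 1))).bind fun a =>
      PMF.pure (F (e a))).toOuterMeasure {κ | P κ} := by
  classical
  have hmap : ((PMF.uniformOfFintype (Fin (N + 1))).bind fun a => PMF.pure (F (e a))) =
      (PMF.uniformOfFintype (Fin (N + 1))).map fun a => F (e a) := rfl
  rw [hmap, PMF.toOuterMeasure_map_apply, PMF.toOuterMeasure_uniformOfFintype_apply,
    Fintype.card_fin]
  have hα : Fintype.card α = N + 1 := by rw [← Fintype.card_congr e, Fintype.card_fin]
  have hc : Fintype.card ((fun a => F (e a)) ⁻¹' {κ | P κ}) =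
      (Finset.univ.filter fun t => P (F t)).card := by
    rw [← Fintype.card_subtype]
    exact Fintype.card_congr (e.subtypeEquiv fun a => Iff.rfl)
  have hcard := Finset.card_filter_add_card_filter_not (s := (Finset.univ : Finset α))
    fun t => P (F t)
  rw [Finset.card_univ, hα, ← hc] at hcard
  rw [hα] at h
  have hcard' : (Fintype.card ((fun a => F (e a)) ⁻¹' {κ | P κ}) : ℝ) +
      (Finset.univ.filter fun t => ¬ P (F t)).card = (N + 1 : ℕ) := by exact_mod_cast hcard
  rw [ENNReal.le_div_iff_mul_le (Or.inl (by positivity)) (Or.inl (by simp)),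
    ← ENNReal.ofReal_natCast (N + 1), ← ENNReal.ofReal_mul' (by positivity),
    ← ENNReal.ofReal_natCast (Fintype.card _)]
  refine ENNReal.ofReal_le_ofReal ?_
  linarith

end Sampling

/-! ### The algorithm and its success probability. -/

section Algorithm

/-- One less than the number of `k`-tuples of `m + 1` nodes. -/
@[irreducible] def lastTuple (m k : ℕ) : ℕ := (m + 1) ^ k - 1

theorem lastTuple_add_one (m k : ℕ) : lastTuple m k + 1 = (m + 1) ^ k := by
  unfold lastTuple
  exact Nat.succ_pred_eq_of_pos (pow_pos m.succ_pos k)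

/-- The codes of the `k`-tuples of nodes. -/
def tupleEquiv (m k : ℕ) : Fin (lastTuple m k + 1) ≃ (Fin k → Fin (m + 1)) :=
  (finCongr (lastTuple_add_one m k)).trans finFunctionFinEquiv.symm

/-- The estimate for the curvature from the mean profits `g` of the sampled objects `t`. -/
def estimate (k M D : ℕ) {n : ℕ} (g : Fin n → ℚ) (t : Fin k → Fin n) : ℚ :=
  -- The shift `n / M` absorbs the sampling error, so that the earth mover's distance is not
  -- underestimated.
  1 - (3 * n - n * (∑ i, g (t i)) / k + n / M) / (1 + D)

/-- The local algorithm: sample `k` objects, explore their neighbourhoods, simulate `N` rounds of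
the auction there, and extrapolate from the profits from the sampled objects. -/
def estimateAlg (f : ℕ) (T : List ℕ) (k M N D : ℕ) : (n : ℕ) → QueryAlg n
  | 0 => .output 1
  | m + 1 => .sample (lastTuple m k) fun a =>
      exploreBall f T (2 * N) (List.ofFn fun i => Sum.inr (tupleEquiv m k a i)) 0 fun K =>
        .output (estimate k M D (meanProfit M (saving T K) N) (tupleEquiv m k a))

/-- By locality, the auction on the known savings gives the true mean profits of the sampled
objects, so the output depends on the sample alone. -/
theorem realizes_estimateAlg_succ {m : ℕ} {w : Fin (m + 1) × Fin (m + 1) → ℕ} {T : List ℕ} {f : ℕ}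
    (h0 : 0 ∉ T) (hf : ∀ s ∈ T, ∀ x, weightDegree w s x ≤ f) (k M N D : ℕ) :
    Realizes w ∅ (estimateAlg f T k M N D (m + 1))
      ((PMF.uniformOfFintype (Fin (lastTuple m k + 1))).bind fun a =>
        PMF.pure (estimate k M D (meanProfit M (saving T w) N) (tupleEquiv m k a)))
      (ballCost (T.length * f) (2 * N) k) := by
  refine realizes_sample fun a => ?_
  have hK : IsSound w T 0 := fun e he => absurd rfl he
  have h := realizes_exploreBall (c := fun K => .output
    (estimate k M D (meanProfit M (saving T K) N) (tupleEquiv m k a)))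
    (p := PMF.pure (estimate k M D (meanProfit M (saving T w) N) (tupleEquiv m k a)))
    h0 hf (2 * N) (l := List.ofFn fun i => Sum.inr (tupleEquiv m k a i)) hK fun K' _ _ h3 => by
      have : estimate k M D (meanProfit M (saving T K') N) (tupleEquiv m k a) =
          estimate k M D (meanProfit M (saving T w) N) (tupleEquiv m k a) := by
        unfold estimate
        congr 6
        refine Finset.sum_congr rfl fun i _ => ?_
        exact (meanProfit_congr (h3 _ ((List.mem_ofFn' _ _).2 ⟨i, rfl⟩))).symm
      rw [this]
      exact realizes_output _ _ _
  have hS : knownEdges (0 : Fin (m + 1) × Fin (m + 1) → ℕ) = ∅ := by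
    simp [knownEdges]
  rwa [hS, List.length_ofFn] at h

/-- Chebyshev's inequality with range `B = 2` and deviation `δ = 1 / M` bounds the failure
probability by `4 * M ^ 2 / k`. -/
theorem le_probOutput_estimateAlg_succ {m : ℕ} {w : Fin (m + 1) × Fin (m + 1) → ℕ} {T : List ℕ}
    {f : ℕ} (h0 : 0 ∉ T) (hf : ∀ s ∈ T, ∀ x, weightDegree w s x ≤ f) {k M N : ℕ} (D : ℕ)
    (hM : 0 < M) (hφ : ∀ e, saving T w e ≤ 2) {η : ℝ} (hk : 4 * M ^ 2 ≤ η * k)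
    {P : ℚ → Prop}
    (hP : ∀ t : Fin k → Fin (m + 1),
      |(m + 1 : ℝ) * (∑ i, (meanProfit M (saving T w) N (t i) : ℝ)) / k -
        ∑ j, (meanProfit M (saving T w) N j : ℝ)| ≤ (m + 1) / M →
      P (estimate k M D (meanProfit M (saving T w) N) t)) :
    ENNReal.ofReal (1 - η) ≤ (estimateAlg f T k M N D (m + 1)).probOutput w P := by
  classical
  have hM' : (0 : ℝ) < M := by exact_mod_cast hM
  have hk0 : 0 < k := by
    rcases Nat.eq_zero_or_pos k with rfl | h
    · have : (0 : ℝ) < 4 * M ^ 2 := by positivity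
      simp only [Nat.cast_zero, mul_zero] at hk
      linarith
    · exact h
  have hk' : (0 : ℝ) < k := by exact_mod_cast hk0
  set g := meanProfit M (saving T w) N with hg
  rw [(realizes_estimateAlg_succ h0 hf k M N D).probOutput_eq]
  refine le_toOuterMeasure_uniform_bind (tupleEquiv m k) (estimate k M D g) P ?_
  rw [Fintype.card_fun, Fintype.card_fin, Fintype.card_fin]
  set bad := Finset.univ.filter fun t : Fin k → Fin (m + 1) =>
    1 / (M : ℝ) * ((m + 1 : ℕ) : ℝ) <
      |((m + 1 : ℕ) : ℝ) * (∑ i, (g (t i) : ℝ)) / k - ∑ j, (g j : ℝ)| with hbad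
  have hg2 : ∀ a, (0 : ℝ) ≤ g a ∧ (g a : ℝ) ≤ 2 := fun a =>
    ⟨by exact_mod_cast meanProfit_nonneg M (saving T w) N a, by
      exact_mod_cast meanProfit_le (M := M) hφ N a⟩
  clear_value g
  have hcheb : (bad.card : ℝ) * ((1 / (M : ℝ)) ^ 2 * k) ≤ 2 ^ 2 * ((m + 1 : ℕ) : ℝ) ^ k :=
    card_filter_deviation_le (g := fun a => (g a : ℝ)) (by positivity) hg2 hk0
  have hsub : (Finset.univ.filter fun t => ¬ P (estimate k M D g t)).card ≤ bad.card := by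
    refine Finset.card_le_card fun t ht => ?_
    rw [Finset.mem_filter] at ht
    rw [hbad, Finset.mem_filter]
    refine ⟨Finset.mem_univ _, ?_⟩
    by_contra hcon
    refine ht.2 (hP _ ?_)
    push_cast at hcon
    rw [not_lt, one_div_mul_eq_div] at hcon
    exact hcon
  refine le_trans (Nat.cast_le.2 hsub) ?_
  have h1 : (bad.card : ℝ) * k ≤ 4 * M ^ 2 * ((m + 1 : ℕ) : ℝ) ^ k := by
    have h2 := mul_le_mul_of_nonneg_right hcheb (sq_nonneg (M : ℝ))
    have h3 : (bad.card : ℝ) * ((1 / (M : ℝ)) ^ 2 * k) * M ^ 2 = bad.card * k := by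
      field_simp
    linarith
  have h2 : 4 * (M : ℝ) ^ 2 * ((m + 1 : ℕ) : ℝ) ^ k ≤ η * k * ((m + 1 : ℕ) : ℝ) ^ k :=
    mul_le_mul_of_nonneg_right hk (by positivity)
  refine le_of_mul_le_mul_right ?_ hk'
  rw [Nat.cast_pow]
  linarith

end Algorithm

/-! ### Error analysis and choice of constants. -/

section Approximation

theorem saving_le_two {n : ℕ} {T : List ℕ} (h0 : 0 ∉ T) (w : Fin n × Fin n → ℕ)
    (e : Fin n × Fin n) : saving T w e ≤ 2 := by
  unfold saving
  split_ifs with h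
  · have : w e ≠ 0 := fun h' => h0 (h' ▸ h)
    omega
  · omega

theorem sum_meanProfit {n : ℕ} (M : ℕ) (φ : Fin n × Fin n → ℕ) (N : ℕ) :
    ∑ j, (meanProfit M φ N j : ℝ) =
      (∑ t ∈ Finset.range N, ∑ j, (ownerProfit φ (auction M φ t) j : ℝ)) / N := by
  unfold meanProfit
  push_cast
  rw [← Finset.sum_div, Finset.sum_comm]

variable {V : Type*} [Fintype V] [DecidableEq V] {G : SimpleGraph V} [DecidableRel G.Adj]
  {u v : V} {n : ℕ}

/-- The total mean profit of the auction determines the earth mover's distance up to the additive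
error `3 - c + 2 / M`, relative to `n`. -/
theorem edgeEmd_bounds (huv : G.Adj u v) (hdeg : G.degree u = G.degree v)
    (eL : Fin n ≃ privateNbr G u v) (eR : Fin n ≃ privateNbr G v u) {T : List ℕ} {M N Δ c : ℕ}
    (hM : 0 < M) (hN : 0 < N) (hN' : 9 * M ^ 2 * Δ ≤ N)
    (hΔ : ∀ j, (Finset.univ.filter fun i => saving T (hWeight G eL eR) (i, j) ≠ 0).card ≤ Δ)
    (hc : ∀ e, c ≤ hWeight G eL eR e + saving T (hWeight G eL eR) e) :
    edgeEmd G u v * (1 + G.degree u) ≤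
        3 * n - ∑ j, (meanProfit M (saving T (hWeight G eL eR)) N j : ℝ) ∧
      (c : ℝ) * n ≤ edgeEmd G u v * (1 + G.degree u) +
        ∑ j, (meanProfit M (saving T (hWeight G eL eR)) N j : ℝ) + 2 * n / M := by
  set φ := saving T (hWeight G eL eR) with hφ
  have hM' : (0 : ℝ) < M := by exact_mod_cast hM
  have hN₀ : (0 : ℝ) < N := by exact_mod_cast hN
  have hφ3 : ∀ e, φ e ≤ 3 := fun e => by
    simp only [hφ, saving]
    split_ifs <;> omega
  set X : ℕ → ℝ := fun t => ∑ j, (ownerProfit φ (auction M φ t) j : ℝ) with hX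
  set E : ℝ := edgeEmd G u v * (1 + G.degree u) with hE
  rw [sum_meanProfit]
  have hupper : ∀ t, E ≤ 3 * n - X t := fun t => edgeEmd_mul_le huv hdeg eL eR T M t
  have hlower : ∀ t, (M * c : ℝ) * n ≤ M * E + M * X t + n +
      M * 3 * (activeBidders M φ (auction M φ t)).card := fun t =>
    le_edgeEmd_mul huv hdeg eL eR hM hc t
  have hactive : (∑ t ∈ Finset.range N, ((activeBidders M φ (auction M φ t)).card : ℝ)) ≤
      Δ * (n * (M * 3)) := by
    exact_mod_cast sum_card_activeBidders_le M hφ3 hΔ N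
  constructor
  · rw [le_sub_iff_add_le, ← le_sub_iff_add_le', div_le_iff₀ hN₀]
    refine (Finset.sum_le_card_nsmul (Finset.range N) X (3 * n - E) fun t _ => ?_).trans ?_
    · linarith [hupper t]
    · simp [mul_comm]
  · have h1 := Finset.sum_le_sum fun t (_ : t ∈ Finset.range N) => hlower t
    simp only [Finset.sum_add_distrib, Finset.sum_const, Finset.card_range, nsmul_eq_mul,
      ← Finset.mul_sum] at h1
    -- In `9 = 3 * 3`, one factor is the loss per active bidder, the other comes from the price
    -- bound `M * 3`.
    have h2 : (M : ℝ) * 3 * ∑ t ∈ Finset.range N,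
        ((activeBidders M φ (auction M φ t)).card : ℝ) ≤ N * n := by
      refine (mul_le_mul_of_nonneg_left hactive (by positivity)).trans ?_
      have h3 : (9 * M ^ 2 * Δ : ℝ) ≤ N := by exact_mod_cast hN'
      have h4 := mul_le_mul_of_nonneg_right h3 (Nat.cast_nonneg (α := ℝ) n)
      linarith
    refine le_of_mul_le_mul_left ?_ (mul_pos hN₀ hM')
    have h5 : (N * M : ℝ) * (E + (∑ t ∈ Finset.range N, X t) / N + 2 * n / M) =
        N * (M * E) + M * ∑ t ∈ Finset.range N, X t + N * (2 * n) := by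
      field_simp
    rw [h5]
    linarith

/-- The error `4 / M` has four equal parts: price increments, active bidders, sampling, and the
shift in `estimate`. The normalisation is harmless since `n ≤ 1 + G.degree u`. -/
theorem isAdditiveCurvatureApprox_estimate (huv : G.Adj u v) (hdeg : G.degree u = G.degree v)
    (eL : Fin n ≃ privateNbr G u v) (eR : Fin n ≃ privateNbr G v u) {T : List ℕ}
    {k M N Δ c : ℕ} (hM : 0 < M) (hN : 0 < N) (hN' : 9 * M ^ 2 * Δ ≤ N)
    (hΔ : ∀ j, (Finset.univ.filter fun i => saving T (hWeight G eL eR) (i, j) ≠ 0).card ≤ Δ)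
    (hc : ∀ e, c ≤ hWeight G eL eR e + saving T (hWeight G eL eR) e) (hc3 : c ≤ 3) {a : ℝ}
    (ha : 3 - c + 4 / (M : ℝ) ≤ a) (t : Fin k → Fin n)
    (ht : |(n : ℝ) * (∑ i, (meanProfit M (saving T (hWeight G eL eR)) N (t i) : ℝ)) / k -
      ∑ j, (meanProfit M (saving T (hWeight G eL eR)) N j : ℝ)| ≤ n / M) :
    IsAdditiveCurvatureApprox G u v a
      ((estimate k M (G.degree v) (meanProfit M (saving T (hWeight G eL eR)) N) t : ℚ) : ℝ) := by
  obtain ⟨h1, h2⟩ := edgeEmd_bounds huv hdeg eL eR hM hN hN' hΔ hc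
  set g := meanProfit M (saving T (hWeight G eL eR)) N
  have hM' : (0 : ℝ) < M := by exact_mod_cast hM
  have hD : (0 : ℝ) < 1 + G.degree u := by positivity
  have hn : (n : ℝ) ≤ 1 + G.degree u := by
    have : (n : ℝ) ≤ G.degree u := by exact_mod_cast card_le_degree G eL
    linarith
  have hc3' : (c : ℝ) ≤ 3 := by exact_mod_cast hc3
  have hest : 1 - ((estimate k M (G.degree v) g t : ℚ) : ℝ) =
      (3 * n - n * (∑ i, (g (t i) : ℝ)) / k + n / M) / (1 + G.degree u) := by
    unfold estimate
    push_cast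
    rw [hdeg]
    ring
  rw [abs_le] at ht
  unfold IsAdditiveCurvatureApprox IsAdditiveEstimate
  rw [hest, le_div_iff₀ hD, div_le_iff₀ hD]
  constructor
  · linarith [ht.2]
  · have h3 : (3 - c + 4 / (M : ℝ)) * n ≤ a * (1 + G.degree u) := by
      have h4 : 0 ≤ 3 - c + 4 / (M : ℝ) := by
        have : 0 ≤ 4 / (M : ℝ) := by positivity
        linarith
      exact mul_le_mul ha hn (Nat.cast_nonneg _) (h4.trans ha)
    have h5 : (3 - c + 4 / (M : ℝ)) * n = 3 * n - c * n + 4 * (n / M) := by ring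
    have h6 : 2 * (n : ℝ) / M = 2 * (n / M) := by ring
    linarith [ht.1]

/-- The local algorithm that queries edges with weights in `T` approximates the curvature with a
constant number of queries, up to the additive error `3 - c + ε`. -/
theorem exists_queryAlg (T : List ℕ) (h0 : 0 ∉ T) {c : ℕ} (hc3 : c ≤ 3)
    (hc : ∀ s ∈ Finset.Icc 1 3, c ≤ s + if s ∈ T then 3 - s else 0) {d ε η a : ℝ}
    (hε : 0 < ε) (hη : 0 < η) (ha : 3 - c + ε ≤ a) :
    ∃ (C : ℝ≥0) (alg : (D n : ℕ) → QueryAlg n),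
      ∀ (V : Type*) [Fintype V] [DecidableEq V] (G : SimpleGraph V) [DecidableRel G.Adj]
        (u v : V) (n : ℕ) (eL : Fin n ≃ privateNbr G u v) (eR : Fin n ≃ privateNbr G v u),
        G.Adj u v → G.degree u = G.degree v →
        (∀ s ∈ T, ∀ x, (weightDegree (hWeight G eL eR) s x : ℝ) ≤ d) →
        (alg (G.degree v) n).expectedQueries (hWeight G eL eR) ≤ (C : ℝ≥0∞) ∧
        ENNReal.ofReal (1 - η) ≤ (alg (G.degree v) n).probOutput (hWeight G eL eR)
          (fun κ => IsAdditiveCurvatureApprox G u v a (κ : ℝ)) := by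
  set f := ⌊d⌋₊ with hf
  set M := ⌈4 / ε⌉₊ with hM
  set Δ := T.length * f with hΔ
  -- The `+ 1` keeps `N` positive when `Δ = 0`, for instance when `d < 1`.
  set N := 9 * M ^ 2 * Δ + 1 with hN
  set k := ⌈4 * (M : ℝ) ^ 2 / η⌉₊ with hk
  have hM0 : 0 < M := Nat.ceil_pos.2 (by positivity)
  have hMε : 4 / (M : ℝ) ≤ ε := by
    have : 4 / ε ≤ M := Nat.le_ceil _
    rw [div_le_iff₀ hε] at this
    rw [div_le_iff₀ (by exact_mod_cast hM0)]
    linarith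
  have hkη : 4 * (M : ℝ) ^ 2 ≤ η * k := by
    have : 4 * (M : ℝ) ^ 2 / η ≤ k := Nat.le_ceil _
    rw [div_le_iff₀ hη] at this
    linarith
  refine ⟨ballCost Δ (2 * N) k, fun D n => estimateAlg f T k M N D n, ?_⟩
  intro V _ _ G _ u v n eL eR huv hdeg hd
  have hfw : ∀ s ∈ T, ∀ x, weightDegree (hWeight G eL eR) s x ≤ f := fun s hs x =>
    Nat.le_floor (hd s hs x)
  rcases n with _ | m
  · have hreal := realizes_output (hWeight G eL eR) ∅ 1
    refine ⟨(hreal.expectedQueries_le).trans (by simp), ?_⟩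
    change _ ≤ QueryAlg.probOutput (.output 1) _ _
    rw [hreal.probOutput_eq, PMF.toOuterMeasure_pure_apply, if_pos]
    · exact ENNReal.ofReal_le_one.2 (by linarith)
    · have h1 := edgeEmd_le huv hdeg eL eR 1
      have h2 := le_edgeEmd huv hdeg eL eR (a := 0) (b := 0) (by simp)
      have hc3' : (c : ℝ) ≤ 3 := by exact_mod_cast hc3
      simp only [Finset.univ_eq_empty, Finset.sum_empty, add_zero, zero_div] at h1 h2
      simp only [Set.mem_ofPred_eq, IsAdditiveCurvatureApprox, IsAdditiveEstimate, Rat.cast_one,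
        sub_self]
      exact ⟨h1, by linarith⟩
  · refine ⟨((realizes_estimateAlg_succ h0 hfw k M N _).expectedQueries_le).trans (by simp [hΔ]),
      le_probOutput_estimateAlg_succ h0 hfw _ hM0 (saving_le_two h0 _) hkη fun t ht => ?_⟩
    refine isAdditiveCurvatureApprox_estimate huv hdeg eL eR (Δ := Δ) hM0 (Nat.succ_pos _)
      (Nat.le_succ _) (fun j => ?_) (fun e => ?_) hc3 (le_trans (by linarith) ha) t ?_
    · refine le_trans (Finset.card_le_card fun i hi => ?_)
        (card_filter_weight_mem_le hfw (Sum.inr j))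
      rw [Finset.mem_filter] at hi ⊢
      exact ⟨hi.1, by_contra fun h => hi.2 (if_neg h)⟩
    · exact hc _ (Finset.mem_Icc.2 ⟨one_le_hWeight huv eL eR e, hWeight_le huv eL eR e⟩)
    · push_cast
      exact ht

end Approximation

end OllivierRicci

end

/-- For constants `d, ε > 0` and every failure probability `η > 0` there are a constant `C` and
algorithms, given only the common degree `D` of `u` and `v` and the size `n` of the two sides of
`H` (with labelled nodes), that make at most `C` weighted neighbour queries in expectation and that
approximate the curvature of the edge `{u, v}` with probability at least `1 - η`. -/
theorem mainTheorem3 (d ε η : ℝ) (hd : 0 < d) (hε : 0 < ε) (hη : 0 < η) :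
    (∃ (C : ℝ≥0) (alg : (D n : ℕ) → OllivierRicci.QueryAlg n),
      ∀ (V : Type*) [Fintype V] [DecidableEq V] (G : SimpleGraph V) [DecidableRel G.Adj]
        (u v : V) (n : ℕ)
        (eL : Fin n ≃ OllivierRicci.privateNbr G u v)
        (eR : Fin n ≃ OllivierRicci.privateNbr G v u),
        G.Adj u v → G.degree u = G.degree v →
        (∀ x, (OllivierRicci.weightDegree (OllivierRicci.hWeight G eL eR) 1 x : ℝ) ≤ d) →
        (alg (G.degree v) n).expectedQueries (OllivierRicci.hWeight G eL eR) ≤ (C : ℝ≥0∞) ∧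
        ENNReal.ofReal (1 - η) ≤
          (alg (G.degree v) n).probOutput (OllivierRicci.hWeight G eL eR)
            (fun κ => OllivierRicci.IsAdditiveCurvatureApprox G u v (1 + ε) (κ : ℝ))) ∧
    (∃ (C : ℝ≥0) (alg : (D n : ℕ) → OllivierRicci.QueryAlg n),
      ∀ (V : Type*) [Fintype V] [DecidableEq V] (G : SimpleGraph V) [DecidableRel G.Adj]
        (u v : V) (n : ℕ)
        (eL : Fin n ≃ OllivierRicci.privateNbr G u v)
        (eR : Fin n ≃ OllivierRicci.privateNbr G v u),
        G.Adj u v → G.degree u = G.degree v →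
        (∀ x, (OllivierRicci.weightDegree (OllivierRicci.hWeight G eL eR) 1 x : ℝ) ≤ d) →
        (∀ x, (OllivierRicci.weightDegree (OllivierRicci.hWeight G eL eR) 2 x : ℝ) ≤ d) →
        (alg (G.degree v) n).expectedQueries (OllivierRicci.hWeight G eL eR) ≤ (C : ℝ≥0∞) ∧
        ENNReal.ofReal (1 - η) ≤
          (alg (G.degree v) n).probOutput (OllivierRicci.hWeight G eL eR)
            (fun κ => OllivierRicci.IsAdditiveCurvatureApprox G u v (1 / 2 + ε) (κ : ℝ))) := by
  refine ⟨?_, ?_⟩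
  -- Weights 2 and 3 are not distinguished, which costs `3 - c = 1`.
  · obtain ⟨C, alg, h⟩ := OllivierRicci.exists_queryAlg [1] (by simp) (c := 2) (by norm_num)
      (by decide) (d := d) hε hη (a := 1 + ε) (by norm_num)
    refine ⟨C, alg, fun V _ _ G _ u v n eL eR huv hdeg h1 => h V G u v n eL eR huv hdeg ?_⟩
    intro s hs
    obtain rfl := List.mem_singleton.1 hs
    exact h1
  -- All savings are visible, so `3 - c = 0` and the summand `1 / 2` is spare.
  · obtain ⟨C, alg, h⟩ := OllivierRicci.exists_queryAlg [1, 2] (by simp) (c := 3) (by norm_num)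
      (by decide) (d := d) hε hη (a := 1 / 2 + ε) (by norm_num)
    refine ⟨C, alg, fun V _ _ G _ u v n eL eR huv hdeg h1 h2 => h V G u v n eL eR huv hdeg ?_⟩
    exact List.forall_mem_cons.2 ⟨h1, List.forall_mem_singleton.2 h2⟩
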